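/- Let $\Omega_1,\Omega_2\subset\mathbb R^2=\mathbb C$ be planar domains (open or closed, bounded or unbounded, not necessarily connected) with disjoint closures and with compact smooth regular boundaries $K_1=\partial\Omega_1$, $K_2=\partial\Omega_2$, each $\Omega_i$ lying locally on one side of $K_i$. Orient $K_i$ as the boundary of $\Omega_i$, that is, with $\Omega_i$ on its left, let $dp_i$ be the length element of $K_i$, and for $(p_1,p_2)\in K_1\times K_2$ let $\theta_i$ be the oriented angle from the positive unit tangent of $K_i$ at $p_i$ to the vector $p_2-p_1$. Define the Möbius mutual energy $$E(\Omega_1,\Omega_2)=\int_{\Omega_1\times\Omega_2}\frac{d^2w\,d^2z}{|z-w|^4},$$ where $d^2w$, $d^2z$ are the area elements. Then all the integrals below converge absolutely, and $$E(\Omega_1,\Omega_2)=-\frac12\int_{K_1\times K_2}\cos\theta_1\cos\theta_2\,\frac{dp_1\,dp_2}{|p_2-p_1|^2},$$ $$E(\Omega_1,\Omega_2)=-\frac12\int_{K_1\times K_2}\sin\theta_1\sin\theta_2\,\frac{dp_1\,dp_2}{|p_2-p_1|^2},$$ $$E(\Omega_1,\Omega_2)=-\frac14\int_{K_1\times K_2}\frac{\overrightarrow{dp_1}\cdot\overrightarrow{dp_2}}{|p_2-p_1|^2},$$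 where $\overrightarrow{dp_1}\cdot\overrightarrow{dp_2}=du_1\wedge du_2+dv_1\wedge dv_2$ for $p_i=(u_i,v_i)\in K_i$. -/

import Mathlib

open MeasureTheory
open scoped ContDiff

namespace PlanarDomain

/-- Near its boundary point `p`, the set `Ω` is the region to the left of a smooth curve which has
direction `τ` at `p`: in the orthonormal frame with origin `p` and positive axes `τ` and `i τ`, the
set `Ω` coincides locally with the region above the graph of a smooth function `g` such that
`g 0 = 0` and `g' 0 = 0`. The points of the graph itself may or may not belong to `Ω`, so that open
and closed domains are both covered. Thus `τ` is the positive unit tangent vector of the boundary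
at `p`, for the orientation that keeps `Ω` on the left. -/
def IsPositiveUnitTangent (Ω : Set ℂ) (p τ : ℂ) : Prop :=
  ‖τ‖ = 1 ∧ ∃ (g : ℝ → ℝ) (r : ℝ), ContDiff ℝ ∞ g ∧ g 0 = 0 ∧ deriv g 0 = 0 ∧ 0 < r ∧
    ∀ z ∈ Metric.ball p r,
      (g ((z - p) / τ).re < ((z - p) / τ).im → z ∈ Ω) ∧
      (((z - p) / τ).im < g ((z - p) / τ).re → z ∉ Ω)

/-- `Ω` has a smooth regular boundary and lies locally on one side of it. -/
def HasSmoothBoundary (Ω : Set ℂ) : Prop :=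
  ∀ p ∈ frontier Ω, ∃ τ : ℂ, IsPositiveUnitTangent Ω p τ

open Classical in
/-- The positive unit tangent vector of the boundary of `Ω` at `p`
(junk value `0` where there is none). -/
noncomputable def positiveTangent (Ω : Set ℂ) (p : ℂ) : ℂ :=
  if h : ∃ τ : ℂ, IsPositiveUnitTangent Ω p τ then h.choose else 0

/-- In a direction strictly to the left of `τ` one enters `Ω`, in a direction strictly to the right
one leaves it. -/
theorem IsPositiveUnitTangent.eventually {Ω : Set ℂ} {p τ : ℂ} (h : IsPositiveUnitTangent Ω p τ)
    (v : ℂ) :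
    (0 < (v / τ).im → ∀ᶠ s : ℝ in nhdsWithin 0 (Set.Ioi 0), p + s * v ∈ Ω) ∧
    ((v / τ).im < 0 → ∀ᶠ s : ℝ in nhdsWithin 0 (Set.Ioi 0), p + s * v ∉ Ω) := by
  obtain ⟨-, g, r, hg, hg0, hg1, hr, H⟩ := h
  have hd : HasDerivAt g 0 (0 * (v / τ).re) := by
    have := (hg.differentiable (by simp)).differentiableAt (x := (0 : ℝ)) |>.hasDerivAt
    rw [hg1] at this
    simpa using this
  have hd2 : HasDerivAt (fun s : ℝ => s * (v / τ).im - g (s * (v / τ).re)) (v / τ).im 0 := by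
    have h1 : HasDerivAt (fun s : ℝ => s * (v / τ).im) (v / τ).im 0 := by
      simpa using (hasDerivAt_id (0 : ℝ)).mul_const (v / τ).im
    have h2 : HasDerivAt (fun s : ℝ => s * (v / τ).re) (v / τ).re 0 := by
      simpa using (hasDerivAt_id (0 : ℝ)).mul_const (v / τ).re
    have h3 : HasDerivAt g 0 ((fun s : ℝ => s * (v / τ).re) 0) := by simpa using hd
    have h4 := h1.sub (h3.comp (0 : ℝ) h2)
    simp only [zero_mul, sub_zero] at h4
    exact h4
  have hs := hasDerivAt_iff_tendsto_slope.1 hd2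
  have hs' := hs.mono_left (nhdsWithin_mono 0
    (show Set.Ioi (0 : ℝ) ⊆ {0}ᶜ from fun x hx => ne_of_gt hx))
  have hball : ∀ᶠ s : ℝ in nhdsWithin 0 (Set.Ioi 0), p + s * v ∈ Metric.ball p r := by
    apply nhdsWithin_le_nhds
    have hc : ContinuousAt (fun s : ℝ => p + s * v) 0 := by fun_prop
    apply hc
    simpa using Metric.ball_mem_nhds p hr
  have key : ∀ s : ℝ, (p + s * v - p) / τ = s * (v / τ) := fun s => by ring
  have hre : ∀ s : ℝ, ((p + s * v - p) / τ).re = s * (v / τ).re := fun s => by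
    rw [key, Complex.re_ofReal_mul]
  have him : ∀ s : ℝ, ((p + s * v - p) / τ).im = s * (v / τ).im := fun s => by
    rw [key, Complex.im_ofReal_mul]
  constructor
  · intro hv
    filter_upwards [hs'.eventually (lt_mem_nhds hv), hball, self_mem_nhdsWithin] with s h1 h2 h3
    refine (H _ h2).1 ?_
    rw [hre, him]
    have h3' : (0 : ℝ) < s := h3
    simp only [slope_def_field, zero_mul, hg0, sub_zero] at h1
    rw [lt_div_iff₀ h3'] at h1
    linarith
  · intro hv
    filter_upwards [hs'.eventually (gt_mem_nhds hv), hball, self_mem_nhdsWithin] with s h1 h2 h3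
    refine (H _ h2).2 ?_
    rw [hre, him]
    have h3' : (0 : ℝ) < s := h3
    simp only [slope_def_field, zero_mul, hg0, sub_zero] at h1
    rw [div_lt_iff₀ h3'] at h1
    linarith

/-- The positive unit tangent vector is unique. -/
theorem IsPositiveUnitTangent.unique {Ω : Set ℂ} {p τ σ : ℂ} (h : IsPositiveUnitTangent Ω p τ)
    (h' : IsPositiveUnitTangent Ω p σ) : τ = σ := by
  have no : ∀ v : ℂ, 0 < (v / τ).im → (v / σ).im < 0 → False := by
    intro v h1 h2
    obtain ⟨s, hs1, hs2⟩ := (((h.eventually v).1 h1).and ((h'.eventually v).2 h2)).exists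
    exact hs2 hs1
  have hτ : τ ≠ 0 := fun h0 => by simpa [h0] using h.1
  have hσ : σ ≠ 0 := fun h0 => by simpa [h0] using h'.1
  by_contra hne
  -- the direction `i (τ - σ)`
  have e1 : τ.re * τ.re + τ.im * τ.im = 1 := by
    rw [← Complex.normSq_apply, Complex.normSq_eq_norm_sq, h.1, one_pow]
  have e2 : σ.re * σ.re + σ.im * σ.im = 1 := by
    rw [← Complex.normSq_apply, Complex.normSq_eq_norm_sq, h'.1, one_pow]
  have n1 : Complex.normSq τ = 1 := by rw [Complex.normSq_apply, e1]
  have n2 : Complex.normSq σ = 1 := by rw [Complex.normSq_apply, e2]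
  have hpos : 0 < (τ.re - σ.re) ^ 2 + (τ.im - σ.im) ^ 2 := by
    have : 0 < Complex.normSq (τ - σ) := Complex.normSq_pos.2 (sub_ne_zero.2 hne)
    rw [Complex.normSq_apply] at this
    simp only [Complex.sub_re, Complex.sub_im] at this
    nlinarith
  refine no (Complex.I * (τ - σ)) ?_ ?_
  · simp [Complex.div_im, n1]
    nlinarith
  · simp [Complex.div_im, n2]
    nlinarith

theorem positiveTangent_spec {Ω : Set ℂ} (hΩ : HasSmoothBoundary Ω) {p : ℂ}
    (hp : p ∈ frontier Ω) : IsPositiveUnitTangent Ω p (positiveTangent Ω p) := by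
  rw [positiveTangent, dif_pos (hΩ p hp)]
  exact (hΩ p hp).choose_spec

/-- The length element of the boundary of `Ω`: one-dimensional Hausdorff measure on `∂Ω`. -/
noncomputable def boundaryLength (Ω : Set ℂ) : Measure ℂ :=
  (Measure.hausdorffMeasure 1).restrict (frontier Ω)

attribute [local instance] Complex.finrank_real_complex_fact

/-- The oriented angle from the positive tangent of the boundary of `Ω` at `p` to the vector `v`. -/
noncomputable def tangentAngle (Ω : Set ℂ) (p v : ℂ) : Real.Angle :=
  Complex.orientation.oangle (positiveTangent Ω p) v

/-- The integrand `|z - w|⁻⁴` of the mutual energy. -/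
noncomputable def energyDensity (q : ℂ × ℂ) : ℝ := 1 / ‖q.2 - q.1‖ ^ 4

/-- The Möbius mutual energy of two planar domains. -/
noncomputable def mutualEnergy (Ω₁ Ω₂ : Set ℂ) : ℝ :=
  ∫ q in Ω₁ ×ˢ Ω₂, energyDensity q

/-- `cos θ₁ cos θ₂ / |p₂ - p₁|²`, where `θᵢ` is the oriented angle from the positive tangent of
`∂Ωᵢ` at `pᵢ` to `p₂ - p₁`. -/
noncomputable def cosCosDensity (Ω₁ Ω₂ : Set ℂ) (p : ℂ × ℂ) : ℝ :=
  (tangentAngle Ω₁ p.1 (p.2 - p.1)).cos * (tangentAngle Ω₂ p.2 (p.2 - p.1)).cos /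
    ‖p.2 - p.1‖ ^ 2

/-- `sin θ₁ sin θ₂ / |p₂ - p₁|²`, with the same angles. -/
noncomputable def sinSinDensity (Ω₁ Ω₂ : Set ℂ) (p : ℂ × ℂ) : ℝ :=
  (tangentAngle Ω₁ p.1 (p.2 - p.1)).sin * (tangentAngle Ω₂ p.2 (p.2 - p.1)).sin /
    ‖p.2 - p.1‖ ^ 2

/-- The density, with respect to length on the two boundaries, of the 2-form
`(du₁ ∧ du₂ + dv₁ ∧ dv₂) / |p₂ - p₁|²` on `∂Ω₁ × ∂Ω₂`, where `pᵢ = uᵢ + i vᵢ`: the value of the form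
on the pair of positive unit tangent vectors. -/
noncomputable def dotDensity (Ω₁ Ω₂ : Set ℂ) (p : ℂ × ℂ) : ℝ :=
  ((positiveTangent Ω₁ p.1).re * (positiveTangent Ω₂ p.2).re +
    (positiveTangent Ω₁ p.1).im * (positiveTangent Ω₂ p.2).im) / ‖p.2 - p.1‖ ^ 2

end PlanarDomain

/-! ### Length of curves and one-dimensional Hausdorff measure -/

section CurveLength

open Set Filter Topology
open scoped NNReal ENNReal

variable {E : Type*} [NormedAddCommGroup E] [NormedSpace ℝ E]

/-! Let `τᵢ` be the positive unit tangents and `v = p₂ - p₁`. Since `v τ̄ᵢ = |v| e^{iθᵢ}`, the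
densities `A = τ̄₁τ₂/|v|²` (`conjDensity`) and `B = τ₁τ₂/v²` (`holoDensity`) have real parts `cos
(θ₁ - θ₂)/|v|²` and `cos (θ₁ + θ₂)/|v|²`. Half their sum and half their difference are the cosine
and sine densities, and `Re A` is the dot density. So all three formulas follow from `E = -¼ ∫ A`
and `∫ B = 0`.

Both come from Green's formula for `(z - a)⁻ᵐ` times the conjugate of `(z - a)⁻ⁿ`, with `a` off the
closure of the domain (`setIntegral_inv_sub_pow`). The case `m = 2`, `n = 0` is Cauchy's theorem and
kills `∫ B`. For `E`, the kernel `|z - w|⁻⁴` has a `∂̄`-primitive in `z`, whose restriction to the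
second boundary has a `∂`-primitive in `w`; each use of Green's formula gives a factor `i/2`, and
`(i/2)² = -1/4`.

Green's formula is proved by straightening the boundary in a volume-preserving chart, then by a
partition of unity, then by dilated cutoffs for unbounded domains. As boundary length is Hausdorff
measure, `comap_hausdorffMeasure_curve` is needed to compute it along a parametrised arc. The energy
converges because disjoint closures leave at most one domain unbounded. -/

theorem HasStrictDerivAt.exists_lipschitzOnWith {γ : ℝ → E} {v : E} {x : ℝ}
    (h : HasStrictDerivAt γ v x) {K : ℝ≥0} (hK : ‖v‖₊ < K) :
    ∃ s ∈ 𝓝 x, LipschitzOnWith K γ s :=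
  h.hasStrictFDerivAt.exists_lipschitzOnWith_of_nnnorm_lt K (by simpa using hK)

theorem HasStrictDerivAt.exists_mul_dist_le {γ : ℝ → E} {v : E} {x : ℝ}
    (h : HasStrictDerivAt γ v x) {c : ℝ≥0} (hc : c < ‖v‖₊) :
    ∃ s ∈ 𝓝 x, ∀ y ∈ s, ∀ z ∈ s, c * dist y z ≤ dist (γ y) (γ z) := by
  -- With linearisation error `‖v‖ - c`, the reverse triangle inequality leaves exactly the
  -- expansion constant `c`.
  obtain ⟨s, hs, H⟩ := h.hasStrictFDerivAt.approximates_deriv_on_nhds (c := ‖v‖₊ - c)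
    (Or.inr (tsub_pos_of_lt hc))
  refine ⟨s, hs, fun y hy z hz => ?_⟩
  have h1 := H y hy z hz
  rw [NNReal.coe_sub hc.le, coe_nnnorm, ContinuousLinearMap.toSpanSingleton_apply] at h1
  have h2 := norm_sub_norm_le ((y - z) • v) (γ y - γ z)
  rw [norm_smul, norm_sub_rev ((y - z) • v), ← dist_eq_norm y z] at h2
  rw [← dist_eq_norm y z] at h1
  rw [dist_eq_norm (γ y)]
  nlinarith

/-- The inverse of `γ` on the image is `c⁻¹`-Lipschitz, and Lipschitz maps increase `μH[1]` by at
most their constant; on the line `μH[1]` is Lebesgue measure. -/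
theorem mul_volume_le_hausdorffMeasure_image {X : Type*} [MetricSpace X] [MeasurableSpace X]
    [BorelSpace X] {γ : ℝ → X} {s t : Set ℝ} {c : ℝ≥0}
    (h : ∀ y ∈ s, ∀ z ∈ s, c * dist y z ≤ dist (γ y) (γ z)) (hts : t ⊆ s) :
    c * volume t ≤ μH[1] (γ '' t) := by
  rcases eq_or_ne c 0 with rfl | hc
  · simp
  have hc' : (0 : ℝ) < c := by positivity
  have hinj : InjOn γ s := fun y hy z hz hyz => by
    have := h y hy z hz
    rw [hyz, dist_self] at this
    exact dist_le_zero.1 (by by_contra! h0; nlinarith)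
  have hL : LipschitzOnWith c⁻¹ (Function.invFunOn γ s) (γ '' t) := by
    refine LipschitzOnWith.of_dist_le_mul ?_
    rintro _ ⟨y, hy, rfl⟩ _ ⟨z, hz, rfl⟩
    rw [hinj.leftInvOn_invFunOn (hts hy), hinj.leftInvOn_invFunOn (hts hz), NNReal.coe_inv,
      inv_mul_eq_div, le_div_iff₀ hc', mul_comm]
    exact h y (hts hy) z (hts hz)
  have h1 := hL.hausdorffMeasure_image_le (d := 1) zero_le_one
  rw [(hinj.leftInvOn_invFunOn.mono hts).image_image, hausdorffMeasure_real,
    ENNReal.rpow_one, ENNReal.coe_inv hc, mul_comm, ← div_eq_mul_inv] at h1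
  rw [mul_comm]
  exact (ENNReal.le_div_iff_mul_le (by simp [hc]) (by simp)).1 h1

variable [MeasurableSpace E] [BorelSpace E]

theorem comap_hausdorffMeasure_le {X : Type*} [MetricSpace X] [MeasurableSpace X]
    [BorelSpace X] {γ : ℝ → X} (hemb : MeasurableEmbedding γ) {K : ℝ≥0} {s t : Set ℝ}
    (hL : LipschitzOnWith K γ s) (hts : t ⊆ s) :
    (μH[1] : Measure X).comap γ t ≤ K * volume t := by
  rw [hemb.comap_apply]
  simpa [hausdorffMeasure_real] using (hL.mono hts).hausdorffMeasure_image_le (d := 1) zero_le_one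

theorem isLocallyFiniteMeasure_comap_hausdorffMeasure {γ : ℝ → E} (hγ : ContDiff ℝ 1 γ)
    (hemb : MeasurableEmbedding γ) :
    IsLocallyFiniteMeasure ((μH[1] : Measure E).comap γ) := by
  refine ⟨fun x => ?_⟩
  obtain ⟨s, hs, hL⟩ := (hγ.contDiffAt.hasStrictDerivAt (x := x) (by simp)).exists_lipschitzOnWith
    (lt_add_one _)
  obtain ⟨r, hr, hrs⟩ := Metric.nhds_basis_closedBall.mem_iff.1 hs
  refine ⟨_, Metric.closedBall_mem_nhds x hr,
    (comap_hausdorffMeasure_le hemb hL hrs).trans_lt ?_⟩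
  exact ENNReal.mul_lt_top ENNReal.coe_lt_top measure_closedBall_lt_top

/-- The density is found by differentiating measures: near `x` the curve distorts distances by
factors arbitrarily close to `‖deriv γ x‖`, which squeezes the ratio of image length to interval
length. -/
theorem comap_hausdorffMeasure_curve {γ : ℝ → E} (hγ : ContDiff ℝ 1 γ)
    (hemb : MeasurableEmbedding γ) :
    (μH[1] : Measure E).comap γ = volume.withDensity fun x => ‖deriv γ x‖ₑ := by
  have hd : ∀ x, HasStrictDerivAt γ (deriv γ x) x := fun x =>
    hγ.contDiffAt.hasStrictDerivAt (by simp)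
  have hfin := isLocallyFiniteMeasure_comap_hausdorffMeasure hγ hemb
  -- Absolute continuity is local, and locally `γ` is Lipschitz.
  have hac : (μH[1] : Measure E).comap γ ≪ volume := by
    refine Measure.AbsolutelyContinuous.mk fun t _ ht => ?_
    refine measure_null_of_locally_null _ fun x _ => ?_
    obtain ⟨s, hs, hL⟩ := (hd x).exists_lipschitzOnWith (lt_add_one _)
    refine ⟨t ∩ s, inter_mem_nhdsWithin t hs, ?_⟩
    refine le_antisymm ((comap_hausdorffMeasure_le hemb hL inter_subset_right).trans ?_) zero_le
    simp [measure_mono_null inter_subset_left ht]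
  rw [← Measure.withDensity_rnDeriv_eq _ _ hac]
  refine withDensity_congr_ae ?_
  filter_upwards [Besicovitch.ae_tendsto_rnDeriv ((μH[1] : Measure E).comap γ) volume] with x hx
  refine tendsto_nhds_unique hx (tendsto_order.2 ⟨fun a ha => ?_, fun a ha => ?_⟩)
  · obtain ⟨c, hac, hc⟩ := ENNReal.lt_iff_exists_nnreal_btwn.1 ha
    obtain ⟨s, hs, H⟩ := (hd x).exists_mul_dist_le (c := c) (by simpa [enorm] using hc)
    obtain ⟨r, hr, hrs⟩ := Metric.nhds_basis_closedBall.mem_iff.1 hs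
    filter_upwards [Ioc_mem_nhdsGT hr] with ρ hρ
    refine hac.trans_le ?_
    rw [ENNReal.le_div_iff_mul_le (by simp [hρ.1])
      (Or.inl measure_closedBall_lt_top.ne), hemb.comap_apply]
    exact mul_volume_le_hausdorffMeasure_image H ((Metric.closedBall_subset_closedBall hρ.2).trans hrs)
  · obtain ⟨c, hc, hca⟩ := ENNReal.lt_iff_exists_nnreal_btwn.1 ha
    obtain ⟨s, hs, H⟩ := (hd x).exists_lipschitzOnWith (K := c) (by simpa [enorm] using hc)
    obtain ⟨r, hr, hrs⟩ := Metric.nhds_basis_closedBall.mem_iff.1 hs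
    filter_upwards [Ioc_mem_nhdsGT hr] with ρ hρ
    refine lt_of_le_of_lt ?_ hca
    exact ENNReal.div_le_of_le_mul (comap_hausdorffMeasure_le hemb H ((Metric.closedBall_subset_closedBall hρ.2).trans hrs))

/-- Integration along the trace of a `C¹` curve with respect to length. -/
theorem setIntegral_range_hausdorffMeasure {F : Type*} [NormedAddCommGroup F] [NormedSpace ℝ F]
    {γ : ℝ → E} (hγ : ContDiff ℝ 1 γ) (hemb : MeasurableEmbedding γ) (k : E → F) :
    ∫ z in range γ, k z ∂μH[1] = ∫ x, ‖deriv γ x‖ • k (γ x) := by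
  rw [← hemb.map_comap, hemb.integral_map, comap_hausdorffMeasure_curve hγ hemb,
    integral_withDensity_eq_integral_toReal_smul]
  · simp
  · exact (hγ.continuous_deriv le_rfl).measurable.enorm
  · simp

end CurveLength

/-! ### Boundary coordinates of a planar domain -/

namespace PlanarDomain

open Set Filter Topology Complex

/-- Coordinates `(x, t)` in the plane, in which `t` is the height over the graph of `g` in the frame
with origin `p` and axes `τ` and `i τ`. -/
noncomputable def graphChart (p τ : ℂ) (g : ℝ → ℝ) (q : ℝ × ℝ) : ℂ :=
  p + τ * (q.1 + (g q.1 + q.2 : ℝ) * I)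

/-- The inverse of `graphChart`. -/
noncomputable def graphChartInv (p τ : ℂ) (g : ℝ → ℝ) (z : ℂ) : ℝ × ℝ :=
  (((z - p) / τ).re, ((z - p) / τ).im - g ((z - p) / τ).re)

section Chart

variable {p τ : ℂ} {g : ℝ → ℝ}

theorem graphChartInv_graphChart (hτ : τ ≠ 0) (q : ℝ × ℝ) :
    graphChartInv p τ g (graphChart p τ g q) = q := by
  have : (graphChart p τ g q - p) / τ = q.1 + (g q.1 + q.2 : ℝ) * I := by
    rw [graphChart, add_sub_cancel_left, mul_div_cancel_left₀ _ hτ]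
  rw [graphChartInv, this]
  ext <;> simp

theorem graphChart_graphChartInv (hτ : τ ≠ 0) (z : ℂ) :
    graphChart p τ g (graphChartInv p τ g z) = z := by
  rw [graphChart, graphChartInv]
  simp only [add_sub_cancel]
  rw [re_add_im, mul_div_cancel₀ _ hτ, add_sub_cancel]

theorem continuous_graphChart (hg : Continuous g) : Continuous (graphChart p τ g) := by
  unfold graphChart; fun_prop

theorem continuous_graphChartInv (hg : Continuous g) : Continuous (graphChartInv p τ g) := by
  unfold graphChartInv; fun_prop

/-- `graphChart` as a homeomorphism. -/
noncomputable def graphHomeomorph (p : ℂ) (hτ : τ ≠ 0) (hg : Continuous g) : ℝ × ℝ ≃ₜ ℂ where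
  toFun := graphChart p τ g
  invFun := graphChartInv p τ g
  left_inv := graphChartInv_graphChart hτ
  right_inv := graphChart_graphChartInv hτ
  continuous_toFun := continuous_graphChart hg
  continuous_invFun := continuous_graphChartInv hg

theorem measurableEmbedding_graphChart (hτ : τ ≠ 0) (hg : Continuous g) :
    MeasurableEmbedding (graphChart p τ g) :=
  (graphHomeomorph p hτ hg).measurableEmbedding

/-- The chart is a shear, the identification of `ℝ × ℝ` with `ℂ`, a rotation and a translation,
composed. -/
theorem measurePreserving_graphChart (hτ : ‖τ‖ = 1) (hg : Continuous g) :
    MeasurePreserving (graphChart p τ g) := by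
  have h1 : MeasurePreserving (fun q : ℝ × ℝ => (q.1, g q.1 + q.2)) := by
    refine MeasurePreserving.skew_product (f := id) (g := fun x t => g x + t)
      (MeasurePreserving.id volume) (by fun_prop) (ae_of_all _ fun x => ?_)
    exact (measurePreserving_add_left volume (g x)).map_eq
  have h2 := volume_preserving_equiv_real_prod.symm
  have h3 : MeasurePreserving (fun z : ℂ => τ * z) := by
    have := (rotation ⟨τ, by simp [Submonoid.unitSphere, hτ]⟩).measurePreserving
    exact this
  have h4 := measurePreserving_add_left (volume : Measure ℂ) p
  have heq : graphChart p τ g = (fun z : ℂ => p + z) ∘ (fun z : ℂ => τ * z) ∘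
      measurableEquivRealProd.symm ∘ fun q : ℝ × ℝ => (q.1, g q.1 + q.2) := by
    funext q
    change graphChart p τ g q = p + τ * ⟨q.1, g q.1 + q.2⟩
    rw [graphChart, mk_eq_add_mul_I]
  rw [heq]
  exact h4.comp (h3.comp (h2.comp h1))

theorem hasFDerivAt_graphChart (hg : ContDiff ℝ ∞ g) (q : ℝ × ℝ) :
    HasFDerivAt (graphChart p τ g)
      ((ContinuousLinearMap.fst ℝ ℝ ℝ).smulRight (τ * (1 + (deriv g q.1 : ℝ) * I)) +
        (ContinuousLinearMap.snd ℝ ℝ ℝ).smulRight (τ * I)) q := by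
  have h1 : HasFDerivAt (fun q : ℝ × ℝ => (q.1 : ℂ)) _ q :=
    ofRealCLM.hasFDerivAt.comp q hasFDerivAt_fst
  have hgd : HasDerivAt g (deriv g q.1) q.1 :=
    ((hg.differentiable (by simp)) q.1).hasDerivAt
  have h2 : HasFDerivAt (fun q : ℝ × ℝ => ((g q.1 + q.2 : ℝ) : ℂ)) _ q :=
    ofRealCLM.hasFDerivAt.comp q ((hgd.hasFDerivAt.comp q hasFDerivAt_fst).add hasFDerivAt_snd)
  have h3 := ((h1.add (h2.mul_const I)).const_mul τ).const_add p
  refine h3.congr_fderiv ?_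
  ext <;> simp
  ring

theorem contDiff_graphChart (hg : ContDiff ℝ ∞ g) : ContDiff ℝ ∞ (graphChart p τ g) := by
  have h1 : ContDiff ℝ ∞ (fun q : ℝ × ℝ => (q.1 : ℂ)) := ofRealCLM.contDiff.comp contDiff_fst
  have h2 : ContDiff ℝ ∞ (fun q : ℝ × ℝ => ((g q.1 + q.2 : ℝ) : ℂ)) :=
    ofRealCLM.contDiff.comp ((hg.comp contDiff_fst).add contDiff_snd)
  unfold graphChart
  fun_prop

/-- The graph of `g` in the frame with origin `p` and axes `τ` and `i τ`, as a curve. -/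
noncomputable def graphCurve (p τ : ℂ) (g : ℝ → ℝ) (x : ℝ) : ℂ := graphChart p τ g (x, 0)

theorem contDiff_graphCurve (hg : ContDiff ℝ ∞ g) : ContDiff ℝ ∞ (graphCurve p τ g) :=
  (contDiff_graphChart hg).comp (by fun_prop)

theorem isClosedEmbedding_graphCurve (hτ : τ ≠ 0) (hg : Continuous g) :
    IsClosedEmbedding (graphCurve p τ g) := by
  refine Function.LeftInverse.isClosedEmbedding (f := fun z => (graphChartInv p τ g z).1) ?_ ?_ ?_
  · intro x
    simp [graphCurve, graphChartInv_graphChart hτ]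
  · exact continuous_fst.comp (continuous_graphChartInv hg)
  · exact (continuous_graphChart hg).comp (by fun_prop)

theorem deriv_graphCurve (hg : ContDiff ℝ ∞ g) (x : ℝ) :
    deriv (graphCurve p τ g) x = τ * (1 + (deriv g x : ℝ) * I) := by
  have h := (hasFDerivAt_graphChart (p := p) (τ := τ) hg (x, 0)).comp_hasDerivAt x
    ((hasDerivAt_id x).prodMk (hasDerivAt_const x (0 : ℝ)))
  exact h.deriv.trans (by simp)

theorem deriv_graphCurve_ne_zero (hτ : τ ≠ 0) (hg : ContDiff ℝ ∞ g) (x : ℝ) :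
    deriv (graphCurve p τ g) x ≠ 0 := by
  rw [deriv_graphCurve hg]
  refine mul_ne_zero hτ fun h => ?_
  simpa using congrArg re h

end Chart
end PlanarDomain

/-! ### Local structure of a domain at its boundary -/

namespace PlanarDomain

open Set Filter Topology Complex

/-- In the open set `U`, the domain `Ω` is the region above the graph of `g` in the frame with
origin `p` and axes `τ` and `i τ`. -/
structure IsAboveGraphOn (Ω : Set ℂ) (p τ : ℂ) (g : ℝ → ℝ) (U : Set ℂ) : Prop where
  norm_eq_one : ‖τ‖ = 1
  contDiff : ContDiff ℝ ∞ g
  isOpen : IsOpen U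
  mem : ∀ q : ℝ × ℝ, graphChart p τ g q ∈ U → 0 < q.2 → graphChart p τ g q ∈ Ω
  notMem : ∀ q : ℝ × ℝ, graphChart p τ g q ∈ U → q.2 < 0 → graphChart p τ g q ∉ Ω

/-- The normalisation of `g` at `0` is dropped, so that one chart serves all boundary points in `U`,
not only `p`. -/
theorem IsPositiveUnitTangent.exists_isAboveGraphOn {Ω : Set ℂ} {p τ : ℂ}
    (h : IsPositiveUnitTangent Ω p τ) :
    ∃ g U, p ∈ U ∧ IsAboveGraphOn Ω p τ g U := by
  obtain ⟨hτ, g, r, hg, -, -, hr, H⟩ := h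
  have hτ0 : τ ≠ 0 := norm_ne_zero_iff.1 (by simp [hτ])
  have key : ∀ q : ℝ × ℝ, (graphChart p τ g q - p) / τ = q.1 + (g q.1 + q.2 : ℝ) * I := fun q => by
    rw [graphChart, add_sub_cancel_left, mul_div_cancel_left₀ _ hτ0]
  refine ⟨g, Metric.ball p r, Metric.mem_ball_self hr, hτ, hg, Metric.isOpen_ball, ?_, ?_⟩
  · intro q hq hq2
    refine (H _ hq).1 ?_
    rw [key]
    simpa using hq2
  · intro q hq hq2
    refine (H _ hq).2 ?_
    rw [key]
    simpa using hq2

/-- If `τ ≠ σ`, the direction `i (τ - σ)` lies strictly to the left of `τ` and strictly to the right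
of `σ`. -/
theorem eq_of_forall_im_div_pos {τ σ : ℂ} (hτ : ‖τ‖ = 1) (hσ : ‖σ‖ = 1)
    (h : ∀ v : ℂ, 0 < (v / τ).im → ¬ (v / σ).im < 0) : τ = σ := by
  have e1 : τ.re * τ.re + τ.im * τ.im = 1 := by
    rw [← Complex.normSq_apply, Complex.normSq_eq_norm_sq, hτ, one_pow]
  have e2 : σ.re * σ.re + σ.im * σ.im = 1 := by
    rw [← Complex.normSq_apply, Complex.normSq_eq_norm_sq, hσ, one_pow]
  have n1 : Complex.normSq τ = 1 := by rw [Complex.normSq_apply, e1]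
  have n2 : Complex.normSq σ = 1 := by rw [Complex.normSq_apply, e2]
  by_contra hne
  have hpos : 0 < (τ.re - σ.re) ^ 2 + (τ.im - σ.im) ^ 2 := by
    have : 0 < Complex.normSq (τ - σ) := Complex.normSq_pos.2 (sub_ne_zero.2 hne)
    rw [Complex.normSq_apply] at this
    simp only [Complex.sub_re, Complex.sub_im] at this
    nlinarith
  refine h (Complex.I * (τ - σ)) ?_ ?_
  · simp [Complex.div_im, n1]
    nlinarith
  · simp [Complex.div_im, n2]
    nlinarith

namespace IsAboveGraphOn

variable {Ω U : Set ℂ} {p τ : ℂ} {g : ℝ → ℝ}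

theorem ne_zero (h : IsAboveGraphOn Ω p τ g U) : τ ≠ 0 :=
  norm_ne_zero_iff.1 (by simp [h.norm_eq_one])

/-- Off the graph a whole neighbourhood lies in `Ω` or in its complement; points of the graph are
limits from both sides. -/
theorem graphChart_mem_frontier (h : IsAboveGraphOn Ω p τ g U) {q : ℝ × ℝ}
    (hq : graphChart p τ g q ∈ U) : graphChart p τ g q ∈ frontier Ω ↔ q.2 = 0 := by
  have hc := continuous_graphChart (p := p) (τ := τ) h.contDiff.continuous
  have hU : IsOpen (graphChart p τ g ⁻¹' U) := h.isOpen.preimage hc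
  have hopen := (graphHomeomorph p h.ne_zero h.contDiff.continuous).isOpenMap
  constructor
  · intro hf
    rcases lt_trichotomy q.2 0 with h0 | h0 | h0
    · exfalso
      have hV : IsOpen (graphChart p τ g '' (graphChart p τ g ⁻¹' U ∩ {q | q.2 < 0})) :=
        hopen _ (hU.inter (isOpen_lt continuous_snd continuous_const))
      obtain ⟨_, ⟨q', hq', rfl⟩, hz⟩ :=
        mem_closure_iff.1 hf.1 _ hV (mem_image_of_mem _ ⟨hq, h0⟩)
      exact h.notMem q' hq'.1 hq'.2 hz
    · exact h0
    · exfalso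
      have hV : IsOpen (graphChart p τ g '' (graphChart p τ g ⁻¹' U ∩ {q | 0 < q.2})) :=
        hopen _ (hU.inter (isOpen_lt continuous_const continuous_snd))
      refine hf.2 (mem_interior.2 ⟨_, ?_, hV, mem_image_of_mem _ ⟨hq, h0⟩⟩)
      rintro _ ⟨q', hq', rfl⟩
      exact h.mem q' hq'.1 hq'.2
  · intro h0
    have hnear : ∀ s : Set ℝ, (0 : ℝ) ∈ closure s → ∀ V : Set ℂ, IsOpen V →
        graphChart p τ g q ∈ V → ∃ t ∈ s, graphChart p τ g (q.1, t) ∈ V := by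
      intro s hs V hV hqV
      have hq0 : graphChart p τ g (q.1, 0) ∈ V := by
        convert hqV
        exact h0.symm
      obtain ⟨t, ht, hts⟩ := mem_closure_iff.1 hs ((fun t : ℝ => graphChart p τ g (q.1, t)) ⁻¹' V)
        (hV.preimage (hc.comp (by fun_prop))) hq0
      exact ⟨t, hts, ht⟩
    rw [frontier_eq_closure_inter_closure]
    constructor
    · refine mem_closure_iff.2 fun V hV hqV => ?_
      obtain ⟨t, ht, htV⟩ := hnear (Ioi 0) (by simp) (V ∩ U) (hV.inter h.isOpen) ⟨hqV, hq⟩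
      exact ⟨_, htV.1, h.mem _ htV.2 ht⟩
    · refine mem_closure_iff.2 fun V hV hqV => ?_
      obtain ⟨t, ht, htV⟩ := hnear (Iio 0) (by simp) (V ∩ U) (hV.inter h.isOpen) ⟨hqV, hq⟩
      exact ⟨_, htV.1, h.notMem _ htV.2 ht⟩

theorem frontier_inter (h : IsAboveGraphOn Ω p τ g U) :
    frontier Ω ∩ U = range (graphCurve p τ g) ∩ U := by
  ext z
  refine and_congr_left fun hz => ?_
  obtain ⟨q, rfl⟩ := (graphHomeomorph p h.ne_zero h.contDiff.continuous).surjective z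
  refine (h.graphChart_mem_frontier hz).trans ⟨fun h0 => ⟨q.1, ?_⟩, ?_⟩
  · rw [graphCurve, ← h0]; rfl
  · rintro ⟨x, hx⟩
    rw [← (graphHomeomorph p h.ne_zero h.contDiff.continuous).injective hx]

theorem volume_frontier_inter (h : IsAboveGraphOn Ω p τ g U) : volume (frontier Ω ∩ U) = 0 := by
  have hmp := measurePreserving_graphChart (p := p) h.norm_eq_one h.contDiff.continuous
  have hemb := measurableEmbedding_graphChart (p := p) h.ne_zero h.contDiff.continuous
  rw [← hmp.measure_preimage_emb hemb]
  refine measure_mono_null (t := univ ×ˢ {0}) ?_ ?_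
  · exact fun q hq => ⟨trivial, (h.graphChart_mem_frontier hq.2).1 hq.1⟩
  · rw [Measure.volume_eq_prod, Measure.prod_prod]
    simp

/-- The positive tangent direction along the graph. -/
theorem norm_smul_positiveTangent (h : IsAboveGraphOn Ω p τ g U) (hΩ : HasSmoothBoundary Ω) {x : ℝ}
    (hx : graphCurve p τ g x ∈ U) :
    (‖deriv (graphCurve p τ g) x‖ : ℂ) * positiveTangent Ω (graphCurve p τ g x) =
      deriv (graphCurve p τ g) x := by
  have hfr : graphCurve p τ g x ∈ frontier Ω := (h.graphChart_mem_frontier hx).2 rfl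
  have hspec := positiveTangent_spec hΩ hfr
  set σ := positiveTangent Ω (graphCurve p τ g x)
  set d := deriv (graphCurve p τ g) x with hd
  have hd0 : d ≠ 0 := deriv_graphCurve_ne_zero h.ne_zero h.contDiff x
  have hdn : (‖d‖ : ℂ) ≠ 0 := by simpa using hd0
  suffices d / ‖d‖ = σ by rw [← this]; field_simp
  -- A direction left of the curve's velocity enters `Ω`, while one right of `σ` leaves it, so no
  -- direction is both.
  refine eq_of_forall_im_div_pos (by simp [hd0]) hspec.1 fun v hv hvσ => ?_
  have hv' : 0 < (v / d).im := by
    have : v / (d / ‖d‖) = (‖d‖ : ℝ) * (v / d) := by field_simp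
    rw [this, im_ofReal_mul] at hv
    exact pos_of_mul_pos_right hv (norm_nonneg _)
  have hI : ∀ᶠ s : ℝ in 𝓝[>] 0, graphCurve p τ g x + s * v ∈ Ω := by
    have hcoord : ∀ s : ℝ, (graphCurve p τ g x + s * v - p) / τ =
        x + g x * I + s * (v / τ) := fun s => by
      have := h.ne_zero
      simp only [graphCurve, graphChart, add_zero]
      field_simp
      ring
    -- The height above the graph along the ray has this initial slope, which is positive when `v`
    -- lies left of the velocity `τ (1 + i g' x)`.
    have hderiv : HasDerivAt (fun s : ℝ => (graphChartInv p τ g (graphCurve p τ g x + s * v)).2)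
        ((v / τ).im - deriv g x * (v / τ).re) 0 := by
      simp only [graphChartInv, hcoord]
      simp only [add_re, add_im, re_ofReal_mul, im_ofReal_mul, ofReal_re, ofReal_im, I_re, I_im,
        mul_zero, mul_one, add_zero, zero_add]
      have h1 : HasDerivAt (fun s : ℝ => g x + s * (v / τ).im) (v / τ).im 0 := by
        simpa using ((hasDerivAt_id (0 : ℝ)).mul_const (v / τ).im).const_add (g x)
      have h2 : HasDerivAt (fun s : ℝ => x + s * (v / τ).re) (v / τ).re 0 := by
        simpa using ((hasDerivAt_id (0 : ℝ)).mul_const (v / τ).re).const_add x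
      have h3 : HasDerivAt g (deriv g x) (x + 0 * (v / τ).re) := by
        simpa using ((h.contDiff.differentiable (by simp)) x).hasDerivAt
      exact h1.sub (h3.comp (0 : ℝ) h2)
    have hpos : 0 < (v / τ).im - deriv g x * (v / τ).re := by
      rw [hd, deriv_graphCurve h.contDiff, ← div_div, div_im] at hv'
      simp only [add_re, one_re, mul_re, ofReal_re, I_re, mul_zero, ofReal_im, I_im, mul_one,
        sub_self, add_zero, add_im, one_im, mul_im, zero_add] at hv'
      rw [← sub_div] at hv'
      have := (div_pos_iff_of_pos_right (normSq_pos.2 fun h0 => by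
        simpa using congrArg re h0)).1 hv'
      linarith
    have hs := (hasDerivAt_iff_tendsto_slope.1 hderiv).mono_left (nhdsWithin_mono 0
      (show Ioi (0 : ℝ) ⊆ {0}ᶜ from fun x hx => ne_of_gt hx))
    have hU : ∀ᶠ s : ℝ in 𝓝[>] 0, graphCurve p τ g x + s * v ∈ U := by
      refine nhdsWithin_le_nhds ?_
      have hc : ContinuousAt (fun s : ℝ => graphCurve p τ g x + s * v) 0 := by fun_prop
      exact hc (by simpa using h.isOpen.mem_nhds hx)
    filter_upwards [hs.eventually (lt_mem_nhds hpos), hU, self_mem_nhdsWithin] with s h1 h2 h3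
    have h4 : (graphChartInv p τ g (graphCurve p τ g x + (0 : ℝ) * v)).2 = 0 := by
      simp [graphCurve, graphChartInv_graphChart h.ne_zero]
    rw [slope_def_field, h4, sub_zero, sub_zero, div_pos_iff_of_pos_right h3] at h1
    rw [← graphChart_graphChartInv (p := p) (g := g) h.ne_zero (graphCurve p τ g x + s * v)]
      at h2 ⊢
    exact h.mem _ h2 h1
  obtain ⟨s, hs1, hs2⟩ := (hI.and ((hspec.eventually v).2 hvσ)).exists
  exact hs2 hs1

/-- The tangent is defined by choice, but on the boundary inside `U` it agrees with the normalised
velocity of the graph, extended to the plane through the first chart coordinate. -/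
theorem continuousWithinAt_positiveTangent (h : IsAboveGraphOn Ω p τ g U)
    (hΩ : HasSmoothBoundary Ω) {z : ℂ} (hz : z ∈ frontier Ω ∩ U) :
    ContinuousWithinAt (positiveTangent Ω) (frontier Ω) z := by
  have hd : Continuous (deriv (graphCurve p τ g)) :=
    (contDiff_graphCurve h.contDiff).continuous_deriv (by simp)
  have hd0 := fun x => deriv_graphCurve_ne_zero (p := p) h.ne_zero h.contDiff x
  set T : ℂ → ℂ := fun z => deriv (graphCurve p τ g) (graphChartInv p τ g z).1 /
    (‖deriv (graphCurve p τ g) (graphChartInv p τ g z).1‖ : ℂ) with hT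
  have hc : Continuous T := by
    have h1 := hd.comp (continuous_fst.comp
      (continuous_graphChartInv (p := p) (τ := τ) h.contDiff.continuous))
    exact h1.div (continuous_ofReal.comp h1.norm) fun z => by simpa using hd0 _
  have heq : EqOn (positiveTangent Ω) T (frontier Ω ∩ U) := by
    intro z hz
    rw [h.frontier_inter] at hz
    obtain ⟨⟨x, rfl⟩, hx⟩ := hz
    have : (graphChartInv p τ g (graphCurve p τ g x)).1 = x := by
      rw [graphCurve, graphChartInv_graphChart h.ne_zero]
    simp only [hT]
    rw [this, eq_div_iff (by simpa using hd0 x), mul_comm]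
    exact h.norm_smul_positiveTangent hΩ hx
  rw [← continuousWithinAt_inter (h.isOpen.mem_nhds hz.2)]
  exact hc.continuousWithinAt.congr heq (heq hz)

theorem finiteAtFilter (h : IsAboveGraphOn Ω p τ g U) {z : ℂ} (hz : z ∈ frontier Ω ∩ U) :
    (μH[1] : Measure ℂ).FiniteAtFilter (𝓝[frontier Ω] z) := by
  have hz' := hz
  rw [h.frontier_inter] at hz'
  obtain ⟨⟨x, rfl⟩, hx⟩ := hz'
  have hemb := (isClosedEmbedding_graphCurve (p := p) h.ne_zero h.contDiff.continuous)
  have := isLocallyFiniteMeasure_comap_hausdorffMeasure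
    ((contDiff_graphCurve (p := p) (τ := τ) h.contDiff).of_le (by simp)) hemb.measurableEmbedding
  obtain ⟨s, hs, hfin⟩ := Measure.finiteAt_nhds ((μH[1] : Measure ℂ).comap (graphCurve p τ g)) x
  rw [hemb.measurableEmbedding.comap_apply] at hfin
  refine ⟨graphCurve p τ g '' s, ?_, hfin⟩
  rw [← nhdsWithin_inter_of_mem' (mem_nhdsWithin_of_mem_nhds (h.isOpen.mem_nhds hx)),
    h.frontier_inter]
  refine nhdsWithin_mono _ inter_subset_left ?_
  rw [← hemb.isEmbedding.map_nhds_eq]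
  exact image_mem_map hs

/-- Integration of a function supported in `U` along the boundary. -/
theorem integral_boundaryLength (h : IsAboveGraphOn Ω p τ g U) (hΩ : HasSmoothBoundary Ω)
    {f : ℂ → ℂ} (hf : Function.support f ⊆ U) :
    ∫ z, f z * positiveTangent Ω z ∂boundaryLength Ω =
      ∫ x, f (graphCurve p τ g x) * deriv (graphCurve p τ g) x := by
  have hemb := (isClosedEmbedding_graphCurve (p := p) h.ne_zero h.contDiff.continuous)
  have h0 : ∀ s : Set ℂ, ∀ z ∈ s \ (s ∩ U), f z * positiveTangent Ω z = 0 := fun s z hz => by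
    have : f z = 0 := by
      by_contra h0
      exact hz.2 ⟨hz.1, hf h0⟩
    rw [this, zero_mul]
  -- Since `f` vanishes off `U`, the domain shrinks from the frontier to its part in `U`, which is
  -- the graph's part in `U`, and then grows to the whole graph.
  rw [boundaryLength, setIntegral_eq_of_subset_of_forall_sdiff_eq_zero
    isClosed_frontier.measurableSet inter_subset_left (h0 _), h.frontier_inter,
    ← setIntegral_eq_of_subset_of_forall_sdiff_eq_zero
    hemb.isClosed_range.measurableSet inter_subset_left (h0 _),
    setIntegral_range_hausdorffMeasure
      ((contDiff_graphCurve (p := p) (τ := τ) h.contDiff).of_le (by simp)) hemb.measurableEmbedding]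
  refine integral_congr_ae (ae_of_all _ fun x => ?_)
  by_cases hx : graphCurve p τ g x ∈ U
  · simp only [real_smul]
    rw [mul_left_comm, h.norm_smul_positiveTangent hΩ hx]
  · have : f (graphCurve p τ g x) = 0 := by
      by_contra h0
      exact hx (hf h0)
    simp [this]

end IsAboveGraphOn
end PlanarDomain

/-! ### Green's formula near a boundary point -/

namespace PlanarDomain

open Set Filter Topology Complex

/-- Twice the Cauchy-Riemann operator `∂/∂z̄`. -/
noncomputable def dbar (f : ℂ → ℂ) (z : ℂ) : ℂ := fderiv ℝ f z 1 + I * fderiv ℝ f z I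

/-- Passing from the frame `1, i` to the rotated frame `τ, τ i` multiplies the operator by `τ`. -/
theorem dbar_eq_of_norm_eq_one {τ : ℂ} (hτ : ‖τ‖ = 1) (f : ℂ → ℂ) (z : ℂ) :
    dbar f z = τ * (fderiv ℝ f z τ + I * fderiv ℝ f z (τ * I)) := by
  have e1 : (τ.re : ℂ) * τ.re + τ.im * τ.im = 1 := by
    rw [← ofReal_mul, ← ofReal_mul, ← ofReal_add, ← normSq_apply, normSq_eq_norm_sq, hτ]
    simp
  have h1 : τ = τ.re • (1 : ℂ) + τ.im • I := by simp [re_add_im]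
  have h2 : τ * I = (-τ.im) • (1 : ℂ) + τ.re • I := by
    apply Complex.ext <;> simp
  have e2 : fderiv ℝ f z τ = τ.re * fderiv ℝ f z 1 + τ.im * fderiv ℝ f z I := by
    conv_lhs => rw [h1, map_add, map_smul, map_smul, real_smul, real_smul]
  have e3 : fderiv ℝ f z (τ * I) = -τ.im * fderiv ℝ f z 1 + τ.re * fderiv ℝ f z I := by
    rw [h2, map_add, map_smul, map_smul, real_smul, real_smul, ofReal_neg]
  rw [e2, e3, dbar]
  conv_rhs => enter [1]; rw [← re_add_im τ]
  linear_combination (-(fderiv ℝ f z 1 + I * fderiv ℝ f z I)) * e1 +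
    (τ.im * τ.im * fderiv ℝ f z 1 - τ.re * τ.im * fderiv ℝ f z I) * I_sq

theorem continuous_dbar {f : ℂ → ℂ} (hf : ContDiff ℝ 1 f) : Continuous (dbar f) := by
  have := hf.continuous_fderiv (by simp)
  unfold dbar
  fun_prop

theorem tsupport_dbar_subset (f : ℂ → ℂ) : tsupport (dbar f) ⊆ tsupport f := by
  refine closure_minimal (fun z hz => ?_) isClosed_closure
  by_contra h0
  have := notMem_tsupport_iff_eventuallyEq.1 h0
  refine hz ?_
  simp [dbar, this.fderiv_eq]

theorem hasCompactSupport_dbar {f : ℂ → ℂ} (hf : HasCompactSupport f) :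
    HasCompactSupport (dbar f) :=
  hf.mono' (subset_closure.trans (tsupport_dbar_subset f))

/-- Green's formula in the half-plane `t > 0`, in terms of two partial derivatives. -/
theorem setIntegral_halfPlane {G : ℝ × ℝ → ℂ} (hG : ContDiff ℝ 1 G) (hGc : HasCompactSupport G)
    {c : ℝ → ℂ} (hc : Continuous c) :
    ∫ q in {q : ℝ × ℝ | 0 < q.2}, (fderiv ℝ G q (1, 0) + c q.1 * fderiv ℝ G q (0, 1)) =
      - ∫ x, c x * G (x, 0) := by
  have hG' := hG.continuous_fderiv (by simp)
  have hd : ∀ q, HasFDerivAt G (fderiv ℝ G q) q := fun q =>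
    ((hG.differentiable (by simp)) q).hasFDerivAt
  have hcs : ∀ v : ℝ × ℝ, HasCompactSupport fun q => fderiv ℝ G q v := fun v =>
    (hGc.fderiv (𝕜 := ℝ)).comp_left (g := fun L : ℝ × ℝ →L[ℝ] ℂ => L v) (by simp)
  have hi1 : Integrable fun q => fderiv ℝ G q (1, 0) :=
    Continuous.integrable_of_hasCompactSupport (by fun_prop) (hcs _)
  have hi2 : Integrable fun q => c q.1 * fderiv ℝ G q (0, 1) :=
    Continuous.integrable_of_hasCompactSupport (by fun_prop) (hcs _).mul_left
  have hset : {q : ℝ × ℝ | 0 < q.2} = univ ×ˢ Ioi 0 := by ext; simp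
  have hx : ∀ t, HasCompactSupport fun x => G (x, t) := fun t =>
    hGc.comp_isClosedEmbedding (Function.LeftInverse.isClosedEmbedding (f := Prod.fst)
      (fun _ => rfl) continuous_fst (by fun_prop))
  have ht : ∀ x, HasCompactSupport fun t => G (x, t) := fun x =>
    hGc.comp_isClosedEmbedding (Function.LeftInverse.isClosedEmbedding (f := Prod.snd)
      (fun _ => rfl) continuous_snd (by fun_prop))
  have hdx : ∀ x t, HasDerivAt (fun x => G (x, t)) (fderiv ℝ G (x, t) (1, 0)) x := fun x t =>
    (hd (x, t)).comp_hasDerivAt x ((hasDerivAt_id x).prodMk (hasDerivAt_const x t))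
  have hdt : ∀ x t, HasDerivAt (fun t => G (x, t)) (fderiv ℝ G (x, t) (0, 1)) t := fun x t =>
    (hd (x, t)).comp_hasDerivAt t ((hasDerivAt_const t x).prodMk (hasDerivAt_id t))
  rw [integral_add hi1.integrableOn hi2.integrableOn]
  -- Horizontal lines stay inside the half-plane, so this derivative integrates to zero on each of
  -- them.
  have e1 : ∫ q in {q : ℝ × ℝ | 0 < q.2}, fderiv ℝ G q (1, 0) = 0 := by
    rw [hset, Measure.volume_eq_prod, ← Measure.prod_restrict, integral_prod_symm,
      ← integral_zero ℝ ℂ]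
    · refine integral_congr_ae (ae_of_all _ fun t => ?_)
      simp only [Measure.restrict_univ]
      have hGt : ContDiff ℝ 1 fun x => G (x, t) := hG.comp (by fun_prop)
      refine integral_eq_zero_of_hasDerivAt_of_integrable (fun x => hdx x t) ?_
        (hGt.continuous.integrable_of_hasCompactSupport (hx t))
      have := (hGt.continuous_deriv le_rfl).integrable_of_hasCompactSupport (μ := volume)
        (hx t).deriv
      exact this.congr (ae_of_all _ fun x => (hdx x t).deriv)
    · rw [Measure.prod_restrict]
      exact hi1.integrableOn
  -- The coefficient depends on `x` only, so it is constant along each vertical ray, where the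
  -- integral gives the boundary value.
  have e2 : ∫ q in {q : ℝ × ℝ | 0 < q.2}, c q.1 * fderiv ℝ G q (0, 1) =
      - ∫ x, c x * G (x, 0) := by
    rw [hset, Measure.volume_eq_prod, setIntegral_prod, Measure.restrict_univ, ← integral_neg]
    · refine integral_congr_ae (ae_of_all _ fun x => ?_)
      have hGx : ContDiff ℝ 1 fun t => G (x, t) := hG.comp (by fun_prop)
      have := (ht x).integral_Ioi_deriv_eq hGx 0
      simp only [(hdt x _).deriv] at this
      simp only
      rw [integral_const_mul, this, mul_neg]
    · exact hi2.integrableOn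
  rw [e1, e2, zero_add]

namespace IsAboveGraphOn

variable {Ω U : Set ℂ} {p τ : ℂ} {g : ℝ → ℝ}

/-- In graph coordinates `dbar` becomes `τ (∂ₓ + (i - g') ∂ₜ)`, so the half-plane formula applies
with `c = i - g'`; the boundary term matches because `-τ (i - g') = -i · τ (1 + i g')`. -/
theorem setIntegral_dbar (h : IsAboveGraphOn Ω p τ g U) (hΩ : HasSmoothBoundary Ω)
    (hmeas : NullMeasurableSet Ω)
    {f : ℂ → ℂ} (hf : ContDiff ℝ 1 f) (hfc : HasCompactSupport f) (hfU : tsupport f ⊆ U) :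
    ∫ z in Ω, dbar f z = -I * ∫ z, f z * positiveTangent Ω z ∂boundaryLength Ω := by
  have hg := h.contDiff.continuous
  have hmp := measurePreserving_graphChart (p := p) h.norm_eq_one hg
  have hemb := measurableEmbedding_graphChart (p := p) h.ne_zero hg
  have hΦ := contDiff_graphChart (p := p) (τ := τ) h.contDiff
  set G : ℝ × ℝ → ℂ := f ∘ graphChart p τ g with hGdef
  have hG : ContDiff ℝ 1 G := hf.comp (hΦ.of_le (by simp))
  have hGc : HasCompactSupport G := hfc.comp_homeomorph (graphHomeomorph p h.ne_zero hg)
  have hGd : ∀ q, HasFDerivAt G _ q := fun q =>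
    ((hf.differentiable (by simp)) (graphChart p τ g q)).hasFDerivAt.comp q
      (hasFDerivAt_graphChart h.contDiff q)
  have hdbar : ∀ q, dbar f (graphChart p τ g q) = τ * (fderiv ℝ G q (1, 0) +
      (I - (deriv g q.1 : ℝ)) * fderiv ℝ G q (0, 1)) := fun q => by
    rw [dbar_eq_of_norm_eq_one h.norm_eq_one, (hGd q).fderiv]
    have e1 : τ * (1 + (deriv g q.1 : ℝ) * I) = τ + (deriv g q.1) • (τ * I) := by
      rw [real_smul]; ring
    simp only [ContinuousLinearMap.comp_apply, _root_.add_apply,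
      ContinuousLinearMap.smulRight_apply, ContinuousLinearMap.coe_fst',
      ContinuousLinearMap.coe_snd', one_smul, zero_smul, add_zero, zero_add]
    rw [e1, map_add, map_smul, real_smul]
    ring
  have hset : ∫ z in Ω, dbar f z = ∫ q in {q : ℝ × ℝ | 0 < q.2}, dbar f (graphChart p τ g q) := by
    rw [← integral_indicator₀ hmeas, ← hmp.integral_comp hemb, ← integral_indicator
      (measurableSet_lt measurable_const measurable_snd)]
    refine integral_congr_ae ?_
    -- Membership in `Ω` is undetermined on the graph itself, a null set.
    have hnull : ∀ᵐ q : ℝ × ℝ, q.2 ≠ 0 := by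
      have : volume (univ ×ˢ {0} : Set (ℝ × ℝ)) = 0 := by
        rw [Measure.volume_eq_prod, Measure.prod_prod]
        simp
      refine measure_mono_null ?_ this
      intro q hq
      exact ⟨trivial, by simpa using hq⟩
    filter_upwards [hnull] with q hq
    by_cases hqU : graphChart p τ g q ∈ U
    · rcases lt_or_gt_of_ne hq with h0 | h0
      · rw [indicator_of_notMem (h.notMem q hqU h0), indicator_of_notMem (by simpa using h0.le)]
      · rw [indicator_of_mem (h.mem q hqU h0), indicator_of_mem (by simpa using h0)]
    · have h0 : dbar f (graphChart p τ g q) = 0 :=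
        image_eq_zero_of_notMem_tsupport fun hq' => hqU (hfU (tsupport_dbar_subset f hq'))
      simp [indicator_apply, h0]
  have hcont : Continuous fun x => I - ((deriv g x : ℝ) : ℂ) :=
    continuous_const.sub (continuous_ofReal.comp (h.contDiff.continuous_deriv (by simp)))
  rw [hset, h.integral_boundaryLength hΩ (subset_closure.trans hfU)]
  simp only [hdbar]
  rw [integral_const_mul, setIntegral_halfPlane hG hGc hcont, ← integral_neg,
    ← integral_const_mul, ← integral_const_mul]
  refine integral_congr_ae (ae_of_all _ fun x => ?_)
  simp only [deriv_graphCurve h.contDiff, hGdef, Function.comp, graphCurve]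
  linear_combination (τ * (deriv g x : ℝ) * f (graphChart p τ g (x, 0))) * I_sq

end IsAboveGraphOn
end PlanarDomain

/-! ### Green's formula for compactly supported functions -/

namespace PlanarDomain

open Set Filter Topology Complex

section Boundary

variable {Ω : Set ℂ}

theorem HasSmoothBoundary.exists_isAboveGraphOn (hΩ : HasSmoothBoundary Ω) {z : ℂ}
    (hz : z ∈ frontier Ω) : ∃ τ g U, z ∈ U ∧ IsAboveGraphOn Ω z τ g U := by
  obtain ⟨τ, hτ⟩ := hΩ z hz
  exact ⟨τ, hτ.exists_isAboveGraphOn⟩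

theorem HasSmoothBoundary.volume_frontier (hΩ : HasSmoothBoundary Ω) :
    volume (frontier Ω) = 0 := by
  refine measure_null_of_locally_null _ fun z hz => ?_
  obtain ⟨τ, g, U, hzU, h⟩ := hΩ.exists_isAboveGraphOn hz
  exact ⟨_, inter_mem_nhdsWithin _ (h.isOpen.mem_nhds hzU), h.volume_frontier_inter⟩

theorem HasSmoothBoundary.nullMeasurableSet (hΩ : HasSmoothBoundary Ω) : NullMeasurableSet Ω :=
  nullMeasurableSet_of_null_frontier hΩ.volume_frontier

theorem HasSmoothBoundary.continuousOn_positiveTangent (hΩ : HasSmoothBoundary Ω) :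
    ContinuousOn (positiveTangent Ω) (frontier Ω) := fun _ hz => by
  obtain ⟨τ, g, U, hzU, h⟩ := hΩ.exists_isAboveGraphOn hz
  exact h.continuousWithinAt_positiveTangent hΩ ⟨hz, hzU⟩

theorem HasSmoothBoundary.isFiniteMeasure_boundaryLength (hΩ : HasSmoothBoundary Ω)
    (hK : IsCompact (frontier Ω)) : IsFiniteMeasure (boundaryLength Ω) := by
  refine ⟨?_⟩
  rw [boundaryLength, Measure.restrict_apply_univ]
  refine hK.measure_lt_top_of_nhdsWithin fun z hz => ?_
  obtain ⟨τ, g, U, hzU, h⟩ := hΩ.exists_isAboveGraphOn hz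
  exact h.finiteAtFilter ⟨hz, hzU⟩

theorem ae_boundaryLength_of_forall {P : ℂ → Prop} (h : ∀ z ∈ frontier Ω, P z) :
    ∀ᵐ z ∂boundaryLength Ω, P z :=
  (ae_restrict_iff' isClosed_frontier.measurableSet).2 (ae_of_all _ h)

theorem restrict_boundaryLength : (boundaryLength Ω).restrict (frontier Ω) = boundaryLength Ω := by
  rw [boundaryLength, Measure.restrict_restrict isClosed_frontier.measurableSet, inter_self]

theorem integrable_boundaryLength {F : Type*} [NormedAddCommGroup F] (hΩ : HasSmoothBoundary Ω)
    (hK : IsCompact (frontier Ω)) {f : ℂ → F} (hf : ContinuousOn f (frontier Ω)) :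
    Integrable f (boundaryLength Ω) := by
  have := hΩ.isFiniteMeasure_boundaryLength hK
  rw [← restrict_boundaryLength]
  exact hf.integrableOn_compact hK

/-- Integration by parts against the constant `1`. -/
theorem integral_dbar_eq_zero {f : ℂ → ℂ} (hf : ContDiff ℝ 1 f) (hfc : HasCompactSupport f) :
    ∫ z, dbar f z = 0 := by
  have hcf := hf.continuous_fderiv (by simp)
  have hi : ∀ v : ℂ, Integrable (fun z => fderiv ℝ f z v) := fun v =>
    Continuous.integrable_of_hasCompactSupport (by fun_prop)
      ((hfc.fderiv (𝕜 := ℝ)).comp_left (g := fun L : ℂ →L[ℝ] ℂ => L v) (by simp))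
  have h0 : ∀ v : ℂ, ∫ z, fderiv ℝ f z v = 0 := fun v => by
    have h := integral_mul_fderiv_eq_neg_fderiv_mul_of_integrable (μ := volume)
      (f := fun _ : ℂ => (1 : ℂ)) (g := f) (v := v) (by simp) (by simpa using hi v)
      (by simpa using hf.continuous.integrable_of_hasCompactSupport hfc) (by simp)
      (fun z _ => (hf.differentiable (by simp)) z)
    simpa using h
  simp only [dbar]
  rw [integral_add (hi 1) ((hi I).const_mul I), integral_const_mul, h0, h0]
  simp

/-- Green's formula for compactly supported functions, locally. -/
theorem exists_forall_setIntegral_dbar (hΩ : HasSmoothBoundary Ω) (z : ℂ) :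
    ∃ U, IsOpen U ∧ z ∈ U ∧ ∀ f : ℂ → ℂ, ContDiff ℝ 1 f → HasCompactSupport f → tsupport f ⊆ U →
      ∫ z in Ω, dbar f z = -I * ∫ z, f z * positiveTangent Ω z ∂boundaryLength Ω := by
  have hbd : ∀ {U : Set ℂ} {f : ℂ → ℂ}, Disjoint U (frontier Ω) → tsupport f ⊆ U →
      ∫ z, f z * positiveTangent Ω z ∂boundaryLength Ω = 0 := by
    intro U f hU hf
    refine integral_eq_zero_of_ae (ae_boundaryLength_of_forall fun z hz => ?_)
    have : f z = 0 := image_eq_zero_of_notMem_tsupport fun h => hU.le_bot ⟨hf h, hz⟩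
    simp [this]
  by_cases hz : z ∈ frontier Ω
  · obtain ⟨τ, g, U, hzU, h⟩ := hΩ.exists_isAboveGraphOn hz
    exact ⟨U, h.isOpen, hzU, fun f hf hfc hfU =>
      h.setIntegral_dbar hΩ hΩ.nullMeasurableSet hf hfc hfU⟩
  -- Away from the frontier both sides vanish: the area integral is over the whole plane for an
  -- interior point, and of zero for an exterior one.
  by_cases hzi : z ∈ interior Ω
  · refine ⟨interior Ω, isOpen_interior, hzi, fun f hf hfc hfU => ?_⟩
    rw [hbd disjoint_interior_frontier hfU, mul_zero, ← integral_dbar_eq_zero hf hfc]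
    refine setIntegral_eq_integral_of_forall_compl_eq_zero fun w hw => ?_
    exact image_eq_zero_of_notMem_tsupport fun h =>
      hw (interior_subset (hfU (tsupport_dbar_subset f h)))
  · refine ⟨(closure Ω)ᶜ, isClosed_closure.isOpen_compl, fun h => hz ⟨h, hzi⟩,
      fun f hf hfc hfU => ?_⟩
    rw [hbd (disjoint_compl_left.mono_right frontier_subset_closure) hfU, mul_zero]
    refine integral_eq_zero_of_ae ?_
    refine ae_mono (Measure.restrict_mono subset_closure le_rfl)
      ((ae_restrict_iff' isClosed_closure.measurableSet).2 (ae_of_all _ fun w hw => ?_))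
    exact image_eq_zero_of_notMem_tsupport fun h => hfU (tsupport_dbar_subset f h) hw

/-- Green's formula for compactly supported functions. -/
theorem setIntegral_dbar (hΩ : HasSmoothBoundary Ω) (hK : IsCompact (frontier Ω))
    {f : ℂ → ℂ} (hf : ContDiff ℝ 1 f) (hfc : HasCompactSupport f) :
    ∫ z in Ω, dbar f z = -I * ∫ z, f z * positiveTangent Ω z ∂boundaryLength Ω := by
  choose U hUo hzU hU using exists_forall_setIntegral_dbar hΩ
  -- The partition is indexed by the points of `ℂ`; local finiteness leaves a finite set `T` of
  -- indices that meet the compact support of `f`.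
  obtain ⟨ρ, hρ⟩ := SmoothPartitionOfUnity.exists_isSubordinate (modelWithCornersSelf ℝ ℂ)
    (isClosed_tsupport f) U hUo (fun z _ => mem_iUnion.2 ⟨z, hzU z⟩)
  set T := (ρ.locallyFinite.finite_nonempty_inter_compact hfc.isCompact).toFinset with hT
  have hsmooth : ∀ i, ContDiff ℝ 1 fun z => (ρ i z : ℂ) * f z := fun i =>
    (ofRealCLM.contDiff.comp ((ρ i).contMDiff.contDiff.of_le (by simp))).mul hf
  have hcs : ∀ i, HasCompactSupport fun z => (ρ i z : ℂ) * f z := fun i => hfc.mul_left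
  have hsub : ∀ i, tsupport (fun z => (ρ i z : ℂ) * f z) ⊆ U i := fun i => by
    refine (closure_mono ?_).trans (hρ i)
    intro z hz h0
    exact hz (by simp [h0])
  have hsum : f = fun z => ∑ i ∈ T, (ρ i z : ℂ) * f z := by
    funext z
    rw [← Finset.sum_mul]
    by_cases hz : z ∈ tsupport f
    · have h1 := ρ.sum_eq_one hz
      rw [finsum_eq_sum_of_support_subset (s := T)] at h1
      · rw [← ofReal_sum, h1, ofReal_one, one_mul]
      · intro i hi
        simp only [hT, Finite.coe_toFinset]
        exact ⟨z, hi, hz⟩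
    · rw [image_eq_zero_of_notMem_tsupport hz, mul_zero]
  have hdbar : ∀ z, dbar f z = ∑ i ∈ T, dbar (fun z => (ρ i z : ℂ) * f z) z := by
    intro z
    have : HasFDerivAt f (∑ i ∈ T, fderiv ℝ (fun z => (ρ i z : ℂ) * f z) z) z :=
      (HasFDerivAt.fun_sum fun i _ =>
        ((hsmooth i).differentiable (by simp) z).hasFDerivAt).congr_of_eventuallyEq
          (Eventually.of_forall (congrFun hsum))
    simp only [dbar]
    rw [this.fderiv]
    simp [Finset.sum_add_distrib, Finset.mul_sum]
  have hbd : ∀ z, f z * positiveTangent Ω z =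
      ∑ i ∈ T, ((ρ i z : ℂ) * f z) * positiveTangent Ω z := by
    intro z
    rw [← Finset.sum_mul]
    exact congrArg (· * positiveTangent Ω z) (congrFun hsum z)
  simp only [hdbar, hbd]
  rw [integral_finsetSum, integral_finsetSum, Finset.mul_sum]
  · exact Finset.sum_congr rfl fun i _ => hU i _ (hsmooth i) (hcs i) (hsub i)
  · exact fun i _ => integrable_boundaryLength hΩ hK
      ((hsmooth i).continuous.continuousOn.mul hΩ.continuousOn_positiveTangent)
  · exact fun i _ => ((continuous_dbar (hsmooth i)).integrable_of_hasCompactSupport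
      (hasCompactSupport_dbar (hcs i))).integrableOn

end Boundary
end PlanarDomain

/-! ### Green's formula for powers of the Cauchy kernel -/

namespace PlanarDomain

open Set Filter Topology Complex
open scoped ComplexConjugate

theorem dbar_mul {f h : ℂ → ℂ} {z : ℂ} (hf : DifferentiableAt ℝ f z)
    (hh : DifferentiableAt ℝ h z) :
    dbar (fun z => f z * h z) z = f z * dbar h z + dbar f z * h z := by
  have : HasFDerivAt (fun z => f z * h z) _ z := hf.hasFDerivAt.mul hh.hasFDerivAt
  rw [dbar, this.fderiv, dbar, dbar]
  simp
  ring

theorem dbar_comp_mul_left {f : ℂ → ℂ} (c : ℝ) {z : ℂ} (hf : DifferentiableAt ℝ f (c * z)) :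
    dbar (fun z => f (c * z)) z = c * dbar f (c * z) := by
  have h1 : HasFDerivAt (fun z : ℂ => (c : ℂ) * z) (c • (1 : ℂ →L[ℝ] ℂ)) z := by
    have := (hasFDerivAt_id (𝕜 := ℝ) z).const_mul (c : ℂ)
    refine this.congr_fderiv ?_
    ext
    simp
  have : HasFDerivAt (fun z => f (c * z)) _ z := hf.hasFDerivAt.comp z h1
  have hv : ∀ v : ℂ, fderiv ℝ f (c * z) (c • v) = c * fderiv ℝ f (c * z) v := fun v => by
    rw [map_smul, real_smul]
  rw [dbar, this.fderiv, dbar]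
  change fderiv ℝ f (c * z) (c • (1 : ℂ)) + I * fderiv ℝ f (c * z) (c • I) = _
  rw [hv, hv]
  ring

/-- The holomorphic factor is annihilated; the `2` is the normalisation of `dbar`. -/
theorem dbar_mul_conj {P Q : ℂ → ℂ} {P' Q' z : ℂ} (hP : HasDerivAt P P' z)
    (hQ : HasDerivAt Q Q' z) :
    dbar (fun z => P z * conj (Q z)) z = 2 * (P z * conj Q') := by
  have h1 := hP.complexToReal_fderiv
  have h2 : HasFDerivAt (fun z => conj (Q z)) _ z :=
    conjCLE.toContinuousLinearMap.hasFDerivAt.comp z hQ.complexToReal_fderiv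
  have h3 : HasFDerivAt (fun z => P z * conj (Q z)) _ z := h1.mul h2
  rw [dbar, h3.fderiv]
  simp
  linear_combination (P' * conj (Q z) - P z * conj Q') * I_sq

theorem dbar_congr {f h : ℂ → ℂ} {z : ℂ} (hfh : f =ᶠ[𝓝 z] h) : dbar f z = dbar h z := by
  rw [dbar, dbar, hfh.fderiv_eq]

variable {Ω : Set ℂ}

/-- `Ω` need not be measurable, so the restriction is compared with that to its closure. -/
theorem ae_restrict_of_forall_mem_closure {P : ℂ → Prop} (h : ∀ z ∈ closure Ω, P z) :
    ∀ᵐ z ∂volume.restrict Ω, P z :=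
  ae_mono (Measure.restrict_mono subset_closure le_rfl)
    ((ae_restrict_iff' isClosed_closure.measurableSet).2 (ae_of_all _ h))

/-- Green's formula for functions that decay at infinity. -/
theorem setIntegral_dbar_of_integrableOn (hΩ : HasSmoothBoundary Ω) (hK : IsCompact (frontier Ω))
    {f : ℂ → ℂ} (hf : ContDiff ℝ 1 f)
    (hfi : IntegrableOn (fun z => ‖f z‖ * (1 + ‖z‖)⁻¹) Ω) (hdi : IntegrableOn (dbar f) Ω) :
    ∫ z in Ω, dbar f z = -I * ∫ z, f z * positiveTangent Ω z ∂boundaryLength Ω := by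
  let χ : ContDiffBump (0 : ℂ) := ⟨1, 2, one_pos, one_lt_two⟩
  set ψ : ℂ → ℂ := fun z => (χ z : ℂ) with hψ
  have hψs : ContDiff ℝ 1 ψ := ofRealCLM.contDiff.comp χ.contDiff
  have hψc : HasCompactSupport ψ := χ.hasCompactSupport.comp_left (g := ofReal) rfl
  have hψ1 : ∀ z, ‖z‖ ≤ 1 → ψ z = 1 := fun z hz => by
    simp only [hψ]
    rw [χ.one_of_mem_closedBall (by simpa using hz), ofReal_one]
  have hψle : ∀ z, ‖ψ z‖ ≤ 1 := fun z => by
    simp only [hψ, norm_real, Real.norm_eq_abs, abs_of_nonneg χ.nonneg]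
    exact χ.le_one
  -- `C` bounds `(1 + ‖z‖) ‖dbar ψ z‖`. As `c n ≤ 1` gives `c n (1 + ‖z‖) ≤ 1 + c n ‖z‖`, the cutoff
  -- error `c n · dbar ψ (c n z)` is at most `C (1 + ‖z‖)⁻¹`, uniformly in `n`.
  obtain ⟨C, hC⟩ := (hasCompactSupport_dbar hψc).mul_left
    (f := fun z => ((1 + ‖z‖ : ℝ) : ℂ)) |>.exists_bound_of_continuous
    ((continuous_ofReal.comp (by fun_prop)).mul (continuous_dbar hψs))
  let c : ℕ → ℝ := fun n => 1 / ((n : ℝ) + 1)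
  have hc0 : ∀ n, 0 < c n := fun n => Nat.one_div_pos_of_nat
  have hc1 : ∀ n, c n ≤ 1 := fun n => by
    rw [div_le_one (by positivity)]
    simp
  have hc : Tendsto c atTop (𝓝 0) := tendsto_one_div_add_atTop_nhds_zero_nat
  have hcs : ∀ n, ContDiff ℝ 1 fun z => ψ (c n * z) := fun n => hψs.comp (by fun_prop)
  have hFc : ∀ n, HasCompactSupport fun z => ψ (c n * z) * f z := fun n => by
    have : HasCompactSupport fun z => ψ (c n * z) :=
      hψc.comp_homeomorph (Homeomorph.mulLeft₀ (c n : ℂ) (by simpa using (hc0 n).ne'))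
    exact this.mul_right
  have hdF : ∀ n z, dbar (fun z => ψ (c n * z) * f z) z =
      ψ (c n * z) * dbar f z + c n * dbar ψ (c n * z) * f z := fun n z => by
    rw [dbar_mul ((hcs n).differentiable (by simp) z) (hf.differentiable (by simp) z),
      dbar_comp_mul_left _ (hψs.differentiable (by simp) _)]
  have hgreen := fun n => setIntegral_dbar hΩ hK ((hcs n).mul hf) (hFc n)
  have hlim : Tendsto (fun n => ∫ z in Ω, dbar (fun z => ψ (c n * z) * f z) z) atTop
      (𝓝 (∫ z in Ω, dbar f z)) := by
    refine tendsto_integral_of_dominated_convergence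
      (fun z => ‖dbar f z‖ + C * (‖f z‖ * (1 + ‖z‖)⁻¹)) ?_ ?_ ?_ ?_
    · exact fun n => (continuous_dbar ((hcs n).mul hf)).aestronglyMeasurable
    · exact hdi.norm.add (hfi.const_mul C)
    · refine fun n => ae_of_all _ fun z => ?_
      rw [hdF]
      refine (norm_add_le _ _).trans (add_le_add ?_ ?_)
      · rw [norm_mul]
        exact mul_le_of_le_one_left (norm_nonneg _) (hψle _)
      · have h1 := hC (c n * z)
        rw [Pi.mul_apply, norm_mul, norm_real, norm_mul, norm_real, Real.norm_of_nonneg (hc0 n).le,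
          Real.norm_of_nonneg (by have := hc0 n; positivity)] at h1
        rw [norm_mul, norm_mul, norm_real, Real.norm_of_nonneg (hc0 n).le, mul_left_comm,
          mul_comm]
        refine mul_le_mul_of_nonneg_left ?_ (norm_nonneg _)
        rw [← div_eq_mul_inv, le_div_iff₀ (by positivity)]
        refine le_trans ?_ h1
        have := norm_nonneg (dbar ψ (c n * z))
        nlinarith [mul_le_mul_of_nonneg_right (hc1 n) this]
    · refine ae_of_all _ fun z => ?_
      simp only [hdF]
      have hcc : Tendsto (fun n => (c n : ℂ)) atTop (𝓝 0) := by
        simpa [Function.comp_def] using (continuous_ofReal.tendsto 0).comp hc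
      have hcz : Tendsto (fun n => (c n : ℂ) * z) atTop (𝓝 0) := by simpa using hcc.mul_const z
      have h1 := ((hψs.continuous.tendsto 0).comp hcz).mul_const (dbar f z)
      have h2 := (hcc.mul (((continuous_dbar hψs).tendsto 0).comp hcz)).mul_const (f z)
      simpa [hψ1 0 (by simp)] using h1.add h2
  -- The boundary side is eventually constant: the cutoff equals `1` on `‖z‖ ≤ n + 1`, which
  -- contains the compact frontier for large `n`.
  refine tendsto_nhds_unique hlim (tendsto_const_nhds.congr' ?_)
  obtain ⟨R, hR⟩ := hK.isBounded.subset_closedBall 0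
  filter_upwards [eventually_ge_atTop ⌈R⌉₊] with n hn
  rw [hgreen]
  congr 1
  refine integral_congr_ae (ae_boundaryLength_of_forall fun z hz => ?_)
  have hz' : ‖z‖ ≤ n + 1 := by
    have h1 := hR hz
    rw [mem_closedBall_zero_iff] at h1
    have h2 : R ≤ n := (Nat.le_ceil R).trans (by exact_mod_cast hn)
    linarith
  have : ψ (c n * z) = 1 := hψ1 _ (by
    rw [norm_mul, norm_real, Real.norm_of_nonneg (hc0 n).le, div_mul_eq_mul_div, one_mul,
      div_le_one (by positivity)]
    exact hz')
  simp [this]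

theorem integrable_inv_one_add_norm_pow {k : ℕ} (hk : 3 ≤ k) :
    Integrable fun z : ℂ => (1 + ‖z‖)⁻¹ ^ k := by
  have h := integrable_one_add_norm (E := ℂ) (μ := volume) (r := k) (by
    rw [finrank_real_complex]
    exact_mod_cast hk)
  refine h.congr (ae_of_all _ fun z => ?_)
  simp only
  rw [Real.rpow_neg (by positivity), Real.rpow_natCast, inv_pow]

theorem inv_norm_sub_le {δ : ℝ} (hδ : 0 < δ) {z a : ℂ} (h : δ ≤ ‖z - a‖) :
    ‖z - a‖⁻¹ ≤ (1 + δ + ‖a‖) / δ * (1 + ‖z‖)⁻¹ := by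
  have h1 : ‖z‖ ≤ ‖z - a‖ + ‖a‖ := by simpa using norm_add_le (z - a) a
  have h2 : 0 < ‖z - a‖ := hδ.trans_le h
  rw [← div_eq_mul_inv, div_div, le_div_iff₀ (by positivity), inv_mul_le_iff₀ h2]
  nlinarith [norm_nonneg a, norm_nonneg z]

theorem exists_pos_forall_le_norm_sub {a : ℂ} (ha : a ∉ closure Ω) :
    ∃ δ > 0, ∀ z ∈ closure Ω, δ ≤ ‖z - a‖ := by
  obtain ⟨δ, hδ, h⟩ := Metric.isOpen_iff.1 isClosed_closure.isOpen_compl a ha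
  refine ⟨δ, hδ, fun z hz => ?_⟩
  by_contra! hlt
  exact h (by simpa [dist_eq_norm] using hlt) hz

theorem integrableOn_inv_sub_pow {a : ℂ} (ha : a ∉ closure Ω) {m n : ℕ} (hmn : 3 ≤ m + n) :
    IntegrableOn (fun z => (z - a)⁻¹ ^ m * conj ((z - a)⁻¹ ^ n)) Ω := by
  obtain ⟨δ, hδ, hd⟩ := exists_pos_forall_le_norm_sub ha
  refine Integrable.mono' ((integrable_inv_one_add_norm_pow hmn).const_mul
    (((1 + δ + ‖a‖) / δ) ^ (m + n))).integrableOn ?_ ?_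
  · exact Measurable.aestronglyMeasurable (by fun_prop)
  · refine ae_restrict_of_forall_mem_closure fun z hz => ?_
    rw [norm_mul, RCLike.norm_conj, norm_pow, norm_pow, ← pow_add, norm_inv, ← mul_pow]
    exact pow_le_pow_left₀ (by positivity) (inv_norm_sub_le hδ (hd z hz)) _

/-- `dbar` sends the boundary integrand's kernel to `-2n` times the kernel on the left. With `m + n
≥ 2` the area integrand decays at least cubically, hence is integrable even when `Ω` is unbounded.
For `n = 0` this is Cauchy's theorem. -/
theorem setIntegral_inv_sub_pow (hΩ : HasSmoothBoundary Ω) (hK : IsCompact (frontier Ω))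
    {a : ℂ} (ha : a ∉ closure Ω) {m n : ℕ} (hmn : 2 ≤ m + n) :
    n * ∫ z in Ω, (z - a)⁻¹ ^ m * conj ((z - a)⁻¹ ^ (n + 1)) =
      I / 2 * ∫ z, (z - a)⁻¹ ^ m * conj ((z - a)⁻¹ ^ n) * positiveTangent Ω z
        ∂boundaryLength Ω := by
  obtain ⟨δ, hδ, hd⟩ := exists_pos_forall_le_norm_sub ha
  -- The bump removes the pole; its radii are below `δ`, so `f` and `k` agree near every point of
  -- the closure.
  let χ : ContDiffBump a := ⟨δ / 3, δ / 2, by positivity, by linarith⟩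
  set k : ℂ → ℂ := fun z => (z - a)⁻¹ ^ m * conj ((z - a)⁻¹ ^ n) with hk
  set f : ℂ → ℂ := fun z => ((1 - χ z : ℝ) : ℂ) * k z with hfdef
  have hf : ContDiff ℝ 1 f := by
    rw [contDiff_iff_contDiffAt]
    intro z
    rcases eq_or_ne z a with rfl | hza
    · refine (contDiffAt_const (c := (0 : ℂ))).congr_of_eventuallyEq ?_
      filter_upwards [χ.eventuallyEq_one] with w hw
      simp [hfdef, hw]
    · have h1 : ContDiffAt ℝ 1 (fun z : ℂ => (z - a)⁻¹) z :=
        (contDiffAt_id.sub contDiffAt_const).inv (sub_ne_zero.2 hza)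
      have h2 : ContDiff ℝ 1 fun z => ((1 - χ z : ℝ) : ℂ) :=
        ofRealCLM.contDiff.comp (contDiff_const.sub χ.contDiff)
      have h3 : ContDiffAt ℝ 1 (fun z : ℂ => conj ((z - a)⁻¹ ^ n)) z :=
        conjCLE.contDiff.contDiffAt.comp z (h1.pow n)
      exact h2.contDiffAt.mul ((h1.pow m).mul h3)
  have heq : ∀ z ∈ closure Ω, f =ᶠ[𝓝 z] k := fun z hz => by
    have : ∀ᶠ w in 𝓝 z, δ / 2 < ‖w - a‖ :=
      (continuous_norm.comp (continuous_id.sub continuous_const)).continuousAt.eventually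
        (lt_mem_nhds (by simpa using (half_lt_self hδ).trans_le (hd z hz)))
    filter_upwards [this] with w hw
    have : χ w = 0 := χ.zero_of_le_dist (by simpa [dist_eq_norm] using hw.le)
    simp [hfdef, this]
  have hdbar : ∀ z ∈ closure Ω,
      dbar f z = -2 * n * ((z - a)⁻¹ ^ m * conj ((z - a)⁻¹ ^ (n + 1))) := fun z hz => by
    have hza : z - a ≠ 0 := norm_pos_iff.1 (hδ.trans_le (hd z hz))
    have h1 : HasDerivAt (fun z : ℂ => (z - a)⁻¹) (-(z - a)⁻¹ ^ 2) z := by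
      refine (((hasDerivAt_id z).sub_const a).fun_inv hza).congr_deriv ?_
      simp [neg_div]
    have h2 : HasDerivAt (fun z : ℂ => (z - a)⁻¹ ^ n) (-n * (z - a)⁻¹ ^ (n + 1)) z := by
      refine (h1.fun_pow n).congr_deriv ?_
      rcases n with _ | n
      · simp
      · rw [Nat.add_sub_cancel]
        ring
    rw [dbar_congr (heq z hz), dbar_mul_conj (h1.fun_pow m) h2]
    simp
    ring
  have hdi : IntegrableOn (dbar f) Ω := by
    refine ((integrableOn_inv_sub_pow ha (m := m) (n := n + 1) (by omega)).const_mul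
      (-2 * n : ℂ)).congr ?_
    exact ae_restrict_of_forall_mem_closure fun z hz => (hdbar z hz).symm
  have hfi : IntegrableOn (fun z => ‖f z‖ * (1 + ‖z‖)⁻¹) Ω := by
    refine Integrable.mono' ((integrable_inv_one_add_norm_pow (k := m + n + 1) (by omega)).const_mul
      (((1 + δ + ‖a‖) / δ) ^ (m + n))).integrableOn ?_ ?_
    · exact (hf.continuous.measurable.norm.mul (by fun_prop)).aestronglyMeasurable
    · refine ae_restrict_of_forall_mem_closure fun z hz => ?_
      rw [Real.norm_of_nonneg (by positivity), (heq z hz).self_of_nhds, hk]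
      simp only
      rw [norm_mul, RCLike.norm_conj, norm_pow, norm_pow, ← pow_add, norm_inv, pow_succ _ (m + n),
        ← mul_assoc, ← mul_pow]
      gcongr
      exact inv_norm_sub_le hδ (hd z hz)
  have hgreen := setIntegral_dbar_of_integrableOn hΩ hK hf hfi hdi
  rw [integral_congr_ae (ae_restrict_of_forall_mem_closure hdbar), integral_const_mul,
    integral_congr_ae (g := fun z => k z * positiveTangent Ω z)
      (ae_boundaryLength_of_forall fun z hz => by
        simp only
        rw [(heq z (frontier_subset_closure hz)).self_of_nhds])] at hgreen
  linear_combination (-1 / 2 : ℂ) * hgreen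

end PlanarDomain

/-! ### The mutual energy as a boundary integral -/

namespace PlanarDomain

open Set Filter Topology Complex
open scoped ComplexConjugate

/-- The exterior of a disc is the exponential image of a half-plane. -/
theorem isPreconnected_setOf_lt_norm {R : ℝ} (hR : 0 < R) : IsPreconnected {z : ℂ | R < ‖z‖} := by
  have h : {z : ℂ | R < ‖z‖} = exp '' {z : ℂ | Real.log R < z.re} := by
    ext z
    constructor
    · intro hz
      have hz' : 0 < ‖z‖ := hR.trans hz
      exact ⟨log z, by simpa [log_re] using Real.log_lt_log hR hz, exp_log (norm_pos_iff.1 hz')⟩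
    · rintro ⟨w, hw, rfl⟩
      simp only [mem_ofPred_eq, norm_exp]
      exact (Real.log_lt_iff_lt_exp hR).1 hw
  rw [h]
  exact (convex_halfSpace_re_gt _).isPreconnected.image _ continuous_exp.continuousOn

variable {Ω Ω₁ Ω₂ : Set ℂ}

/-- The exterior of a large disc is connected and misses the frontier, so it lies in the interior of
`Ω` or off its closure; unboundedness excludes the latter. -/
theorem setOf_lt_norm_subset {R : ℝ} (hR : 0 < R) (hK : frontier Ω ⊆ Metric.closedBall 0 R)
    (hΩ : ¬ Bornology.IsBounded Ω) : {z : ℂ | R < ‖z‖} ⊆ Ω := by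
  have hsplit : ∀ z : ℂ, R < ‖z‖ → z ∉ frontier Ω := fun z hz h => by
    have := hK h
    rw [mem_closedBall_zero_iff] at this
    exact this.not_gt hz
  obtain ⟨z, hz, hzR⟩ : ∃ z ∈ Ω, R < ‖z‖ := by
    by_contra! h
    exact hΩ (Metric.isBounded_closedBall.subset fun z hz => mem_closedBall_zero_iff.2 (h z hz))
  refine Subset.trans ?_ (interior_subset (s := Ω))
  refine (isPreconnected_setOf_lt_norm hR).subset_left_of_subset_union isOpen_interior
    isClosed_closure.isOpen_compl (disjoint_compl_right.mono_left
      (interior_subset.trans subset_closure)) ?_ ⟨z, hzR, ?_⟩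
  · intro w hw
    by_cases h : w ∈ interior Ω
    · exact Or.inl h
    · exact Or.inr fun hc => hsplit w hw ⟨hc, h⟩
  · by_contra h
    exact hsplit z hzR ⟨subset_closure hz, h⟩

/-- Two unbounded domains would both contain the exterior of one large disc. -/
theorem isBounded_or_isBounded (hK₁ : IsCompact (frontier Ω₁)) (hK₂ : IsCompact (frontier Ω₂))
    (hdisj : Disjoint (closure Ω₁) (closure Ω₂)) :
    Bornology.IsBounded Ω₁ ∨ Bornology.IsBounded Ω₂ := by
  by_contra! h
  obtain ⟨R, hR, hKR⟩ := (hK₁.isBounded.union hK₂.isBounded).subset_closedBall_lt 0 0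
  have h1 := setOf_lt_norm_subset hR (subset_union_left.trans hKR) h.1
  have h2 := setOf_lt_norm_subset hR (subset_union_right.trans hKR) h.2
  have hz : ((R + 1 : ℝ) : ℂ) ∈ {z : ℂ | R < ‖z‖} := by
    simp only [mem_ofPred_eq, norm_real]
    exact lt_of_lt_of_le (lt_add_one R) (Real.le_norm_self _)
  exact hdisj.le_bot ⟨subset_closure (h1 hz), subset_closure (h2 hz)⟩

theorem exists_pos_forall_le_norm_sub_of_disjoint (hb : Bornology.IsBounded Ω₁)
    (hdisj : Disjoint (closure Ω₁) (closure Ω₂)) :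
    ∃ δ > 0, ∀ w ∈ closure Ω₁, ∀ z ∈ closure Ω₂, δ ≤ ‖z - w‖ := by
  obtain ⟨δ, hδ, h⟩ := hdisj.exists_thickenings hb.isCompact_closure isClosed_closure
  refine ⟨δ, hδ, fun w hw z hz => ?_⟩
  by_contra! hlt
  refine h.le_bot ⟨Metric.mem_thickening_iff.2 ⟨w, hw, ?_⟩, Metric.self_subset_thickening hδ _ hz⟩
  rwa [dist_eq_norm]

theorem exists_forall_inv_norm_sub_le (hb : Bornology.IsBounded Ω₁)
    (hdisj : Disjoint (closure Ω₁) (closure Ω₂)) :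
    ∃ C : ℝ, ∀ w ∈ closure Ω₁, ∀ z ∈ closure Ω₂, ‖z - w‖⁻¹ ≤ C * (1 + ‖z‖)⁻¹ := by
  obtain ⟨δ, hδ, h⟩ := exists_pos_forall_le_norm_sub_of_disjoint hb hdisj
  obtain ⟨M, hM, hbM⟩ := hb.closure.subset_closedBall_lt 0 0
  refine ⟨(1 + δ + M) / δ, fun w hw z hz => ?_⟩
  refine (inv_norm_sub_le hδ (h w hw z hz)).trans ?_
  have := mem_closedBall_zero_iff.1 (hbM hw)
  gcongr

theorem ae_prod_of_ae {μ ν : Measure ℂ} [SFinite ν] {P Q : ℂ → Prop} (hP : ∀ᵐ w ∂μ, P w)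
    (hQ : ∀ᵐ z ∂ν, Q z) : ∀ᵐ p ∂μ.prod ν, P p.1 ∧ Q p.2 :=
  (Measure.quasiMeasurePreserving_fst.ae hP).and (Measure.quasiMeasurePreserving_snd.ae hQ)

/-- The density is dominated by `C⁴ (1 + ‖z‖)⁻⁴`, integrable over a set of finite area times the
plane. -/
theorem integrableOn_energyDensity_of_isBounded (hb : Bornology.IsBounded Ω₁)
    (hdisj : Disjoint (closure Ω₁) (closure Ω₂)) :
    IntegrableOn energyDensity (Ω₁ ×ˢ Ω₂) := by
  obtain ⟨C, hC⟩ := exists_forall_inv_norm_sub_le hb hdisj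
  have : IsFiniteMeasure (volume.restrict Ω₁) := ⟨by
    rw [Measure.restrict_apply_univ]
    exact hb.measure_lt_top⟩
  rw [IntegrableOn, Measure.volume_eq_prod, ← Measure.prod_restrict]
  refine Integrable.mono' ((integrable_const (C ^ 4)).mul_prod
    (integrable_inv_one_add_norm_pow (k := 4) (by norm_num)).integrableOn) ?_ ?_
  · refine Measurable.aestronglyMeasurable ?_
    unfold energyDensity
    fun_prop
  · filter_upwards [ae_prod_of_ae
      (ae_restrict_of_forall_mem_closure (Ω := Ω₁) (P := (· ∈ closure Ω₁)) fun _ h => h)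
      (ae_restrict_of_forall_mem_closure (Ω := Ω₂) (P := (· ∈ closure Ω₂)) fun _ h => h)]
      with p hp
    rw [energyDensity, Real.norm_of_nonneg (by positivity), one_div, ← inv_pow, ← mul_pow]
    exact pow_le_pow_left₀ (by positivity) (hC _ hp.1 _ hp.2) _

theorem integrableOn_energyDensity (hK₁ : IsCompact (frontier Ω₁)) (hK₂ : IsCompact (frontier Ω₂))
    (hdisj : Disjoint (closure Ω₁) (closure Ω₂)) :
    IntegrableOn energyDensity (Ω₁ ×ˢ Ω₂) := by
  rcases isBounded_or_isBounded hK₁ hK₂ hdisj with hb | hb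
  · exact integrableOn_energyDensity_of_isBounded hb hdisj
  · have h := integrableOn_energyDensity_of_isBounded hb hdisj.symm
    rw [IntegrableOn, Measure.volume_eq_prod, ← Measure.prod_restrict] at h ⊢
    refine h.swap.congr (ae_of_all _ fun p => ?_)
    simp [energyDensity, norm_sub_rev]

theorem notMem_closure_of_disjoint (hdisj : Disjoint (closure Ω₁) (closure Ω₂)) {w : ℂ}
    (hw : w ∈ closure Ω₁) : w ∉ closure Ω₂ := fun h => hdisj.le_bot ⟨hw, h⟩

theorem integrable_boundaryLength_prod (hΩ₁ : HasSmoothBoundary Ω₁) (hΩ₂ : HasSmoothBoundary Ω₂)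
    (hK₁ : IsCompact (frontier Ω₁)) (hK₂ : IsCompact (frontier Ω₂)) {f : ℂ × ℂ → ℂ}
    (hf : ContinuousOn f (frontier Ω₁ ×ˢ frontier Ω₂)) :
    Integrable f ((boundaryLength Ω₁).prod (boundaryLength Ω₂)) := by
  have := hΩ₁.isFiniteMeasure_boundaryLength hK₁
  have := hΩ₂.isFiniteMeasure_boundaryLength hK₂
  rw [← restrict_boundaryLength (Ω := Ω₁), ← restrict_boundaryLength (Ω := Ω₂),
    Measure.prod_restrict]
  exact hf.integrableOn_compact (hK₁.prod hK₂)

theorem ae_boundaryLength_prod {P : ℂ × ℂ → Prop} [SFinite (boundaryLength Ω₂)]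
    (h : ∀ w ∈ frontier Ω₁, ∀ z ∈ frontier Ω₂, P (w, z)) :
    ∀ᵐ p ∂(boundaryLength Ω₁).prod (boundaryLength Ω₂), P p := by
  filter_upwards [ae_prod_of_ae
    (ae_boundaryLength_of_forall (Ω := Ω₁) (P := (· ∈ frontier Ω₁)) fun _ h => h)
    (ae_boundaryLength_of_forall (Ω := Ω₂) (P := (· ∈ frontier Ω₂)) fun _ h => h)] with p hp
  exact h _ hp.1 _ hp.2

/-- The complex density `τ̄₁ τ₂ / |p₂ - p₁|²`. -/
noncomputable def conjDensity (Ω₁ Ω₂ : Set ℂ) (p : ℂ × ℂ) : ℂ :=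
  conj (positiveTangent Ω₁ p.1) * positiveTangent Ω₂ p.2 *
    ((p.2 - p.1)⁻¹ * conj (p.2 - p.1)⁻¹)

/-- The complex density `τ₁ τ₂ / (p₂ - p₁)²`. -/
noncomputable def holoDensity (Ω₁ Ω₂ : Set ℂ) (p : ℂ × ℂ) : ℂ :=
  positiveTangent Ω₁ p.1 * positiveTangent Ω₂ p.2 * (p.2 - p.1)⁻¹ ^ 2

theorem continuousOn_densities (hΩ₁ : HasSmoothBoundary Ω₁) (hΩ₂ : HasSmoothBoundary Ω₂)
    (hdisj : Disjoint (closure Ω₁) (closure Ω₂)) :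
    ContinuousOn (conjDensity Ω₁ Ω₂) (frontier Ω₁ ×ˢ frontier Ω₂) ∧
      ContinuousOn (holoDensity Ω₁ Ω₂) (frontier Ω₁ ×ˢ frontier Ω₂) := by
  have h1 : ContinuousOn (fun p : ℂ × ℂ => positiveTangent Ω₁ p.1)
      (frontier Ω₁ ×ˢ frontier Ω₂) :=
    hΩ₁.continuousOn_positiveTangent.comp continuousOn_fst fun p hp => hp.1
  have h2 : ContinuousOn (fun p : ℂ × ℂ => positiveTangent Ω₂ p.2)
      (frontier Ω₁ ×ˢ frontier Ω₂) :=
    hΩ₂.continuousOn_positiveTangent.comp continuousOn_snd fun p hp => hp.2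
  have h3 : ContinuousOn (fun p : ℂ × ℂ => (p.2 - p.1)⁻¹) (frontier Ω₁ ×ˢ frontier Ω₂) := by
    refine ContinuousOn.inv₀ (by fun_prop) fun p hp h0 => ?_
    refine notMem_closure_of_disjoint hdisj (frontier_subset_closure hp.1) ?_
    rw [← sub_eq_zero.1 h0]
    exact frontier_subset_closure hp.2
  exact ⟨((continuous_conj.comp_continuousOn h1).mul h2).mul
    (h3.mul (continuous_conj.comp_continuousOn h3)), (h1.mul h2).mul (h3.pow 2)⟩

/-- For fixed `p₁` the kernel `(z - p₁)⁻²` is holomorphic near the closure of `Ω₂` and decays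
quadratically, so Cauchy's theorem applies to the inner integral. -/
theorem integral_holoDensity (hΩ₁ : HasSmoothBoundary Ω₁) (hΩ₂ : HasSmoothBoundary Ω₂)
    (hK₁ : IsCompact (frontier Ω₁)) (hK₂ : IsCompact (frontier Ω₂))
    (hdisj : Disjoint (closure Ω₁) (closure Ω₂)) :
    ∫ p, holoDensity Ω₁ Ω₂ p ∂((boundaryLength Ω₁).prod (boundaryLength Ω₂)) = 0 := by
  have := hΩ₁.isFiniteMeasure_boundaryLength hK₁
  have := hΩ₂.isFiniteMeasure_boundaryLength hK₂
  rw [integral_prod _ (integrable_boundaryLength_prod hΩ₁ hΩ₂ hK₁ hK₂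
    (continuousOn_densities hΩ₁ hΩ₂ hdisj).2)]
  refine integral_eq_zero_of_ae (ae_boundaryLength_of_forall fun w hw => ?_)
  have h := setIntegral_inv_sub_pow hΩ₂ hK₂
    (notMem_closure_of_disjoint hdisj (frontier_subset_closure hw)) (m := 2) (n := 0) le_rfl
  have h0 : ∫ z, (z - w)⁻¹ ^ 2 * positiveTangent Ω₂ z ∂boundaryLength Ω₂ = 0 := by
    simpa using h.symm
  simp only [holoDensity, Pi.zero_apply]
  rw [← mul_zero (positiveTangent Ω₁ w), ← h0, ← integral_const_mul]
  exact integral_congr_ae (ae_of_all _ fun z => by simp only; ring)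

/-- This justifies exchanging the integrals between the two uses of Green's formula. The second
variable stays on a compact curve, so the cubic decay in the first suffices for unbounded `Ω₁`. -/
theorem integrable_mixed (hΩ₂ : HasSmoothBoundary Ω₂) (hK₂ : IsCompact (frontier Ω₂))
    (hdisj : Disjoint (closure Ω₁) (closure Ω₂)) :
    Integrable (fun p : ℂ × ℂ => (p.2 - p.1)⁻¹ ^ 2 * conj ((p.2 - p.1)⁻¹ ^ 1) *
      positiveTangent Ω₂ p.2) ((volume.restrict Ω₁).prod (boundaryLength Ω₂)) := by
  have := hΩ₂.isFiniteMeasure_boundaryLength hK₂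
  obtain ⟨C, hC⟩ := exists_forall_inv_norm_sub_le (Ω₁ := frontier Ω₂) (Ω₂ := Ω₁) hK₂.isBounded
    (by rw [isClosed_frontier.closure_eq]; exact (hdisj.mono_right frontier_subset_closure).symm)
  refine Integrable.mono' ((integrable_inv_one_add_norm_pow le_rfl).integrableOn.mul_prod
    (integrable_const (C ^ 3))) ?_ ?_
  · refine AEStronglyMeasurable.mul (Measurable.aestronglyMeasurable (by fun_prop)) ?_
    exact (integrable_boundaryLength hΩ₂ hK₂
      hΩ₂.continuousOn_positiveTangent).aestronglyMeasurable.comp_snd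
  · filter_upwards [ae_prod_of_ae
      (ae_restrict_of_forall_mem_closure (Ω := Ω₁) (P := (· ∈ closure Ω₁)) fun _ h => h)
      (ae_boundaryLength_of_forall (Ω := Ω₂) (P := (· ∈ frontier Ω₂)) fun _ h => h)] with p hp
    rw [norm_mul, norm_mul, RCLike.norm_conj, norm_pow, norm_pow, ← pow_add, norm_inv,
      (positiveTangent_spec hΩ₂ hp.2).1, mul_one, mul_comm _ (C ^ 3), ← mul_pow, norm_sub_rev]
    exact pow_le_pow_left₀ (by positivity) (hC _ (subset_closure hp.2) _ hp.1) _

theorem mutualEnergy_eq_integral_conjDensity (hΩ₁ : HasSmoothBoundary Ω₁)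
    (hΩ₂ : HasSmoothBoundary Ω₂)
    (hK₁ : IsCompact (frontier Ω₁)) (hK₂ : IsCompact (frontier Ω₂))
    (hdisj : Disjoint (closure Ω₁) (closure Ω₂)) :
    (mutualEnergy Ω₁ Ω₂ : ℂ) =
      -(1 / 4) * ∫ p, conjDensity Ω₁ Ω₂ p ∂((boundaryLength Ω₁).prod (boundaryLength Ω₂)) := by
  have := hΩ₁.isFiniteMeasure_boundaryLength hK₁
  have := hΩ₂.isFiniteMeasure_boundaryLength hK₂
  have hE := integrableOn_energyDensity hK₁ hK₂ hdisj
  have hE' : IntegrableOn (fun q => (energyDensity q : ℂ)) (Ω₁ ×ˢ Ω₂)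
      ((volume : Measure ℂ).prod volume) := hE.ofReal
  have hden : ∀ w z : ℂ, (energyDensity (w, z) : ℂ) =
      (z - w)⁻¹ ^ 2 * conj ((z - w)⁻¹ ^ (1 + 1)) := fun w z => by
    rw [map_pow, ← mul_pow, mul_conj, normSq_eq_norm_sq, energyDensity, norm_inv]
    push_cast
    ring
  have h1 : ∀ w ∈ closure Ω₁, ∫ z in Ω₂, (energyDensity (w, z) : ℂ) =
      I / 2 * ∫ z, (z - w)⁻¹ ^ 2 * conj ((z - w)⁻¹ ^ 1) * positiveTangent Ω₂ z
        ∂boundaryLength Ω₂ := fun w hw => by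
    simp only [hden]
    rw [← setIntegral_inv_sub_pow hΩ₂ hK₂ (notMem_closure_of_disjoint hdisj hw) (by norm_num)]
    simp
  have h2 : ∀ z ∈ frontier Ω₂, ∫ w in Ω₁, (z - w)⁻¹ ^ 2 * conj ((z - w)⁻¹ ^ 1) =
      I / 2 * ∫ w, conj (positiveTangent Ω₁ w) * ((z - w)⁻¹ * conj (z - w)⁻¹)
        ∂boundaryLength Ω₁ := fun z hz => by
    -- A `∂`-primitive is needed in `w`, so Green's formula is conjugated; this is why `τ₁` enters
    -- conjugated. The sign from conjugating `i/2` cancels that of the three factors `w - z = -(z -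
    -- w)`.
    have h := congrArg conj (setIntegral_inv_sub_pow hΩ₁ hK₁ (notMem_closure_of_disjoint hdisj.symm
      (frontier_subset_closure hz)) (m := 1) (n := 1) le_rfl)
    have hI : conj (I / 2) = -(I / 2) := by
      rw [map_div₀, conj_I, map_ofNat, neg_div]
    rw [map_mul, map_mul, ← integral_conj, ← integral_conj, hI] at h
    have e1 : ∀ w : ℂ, conj ((w - z)⁻¹ ^ 1 * conj ((w - z)⁻¹ ^ (1 + 1))) =
        -((z - w)⁻¹ ^ 2 * conj ((z - w)⁻¹ ^ 1)) := fun w => by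
      rw [← neg_sub z w, inv_neg]
      simp
      ring
    have e2 : ∀ w : ℂ, conj ((w - z)⁻¹ ^ 1 * conj ((w - z)⁻¹ ^ 1) * positiveTangent Ω₁ w) =
        conj (positiveTangent Ω₁ w) * ((z - w)⁻¹ * conj (z - w)⁻¹) := fun w => by
      rw [← neg_sub z w, inv_neg]
      simp
      ring
    simp only [e1, e2] at h
    rw [integral_neg, Nat.cast_one, map_one] at h
    linear_combination -h
  rw [mutualEnergy, ← integral_complex_ofReal, Measure.volume_eq_prod, setIntegral_prod _ hE',
    integral_congr_ae (ae_restrict_of_forall_mem_closure h1), integral_const_mul,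
    integral_integral_swap (integrable_mixed hΩ₂ hK₂ hdisj),
    integral_prod_symm _ (integrable_boundaryLength_prod hΩ₁ hΩ₂ hK₁ hK₂
      (continuousOn_densities hΩ₁ hΩ₂ hdisj).1)]
  have h3 : ∀ z ∈ frontier Ω₂, ∫ w in Ω₁, (z - w)⁻¹ ^ 2 * conj ((z - w)⁻¹ ^ 1) *
      positiveTangent Ω₂ z = I / 2 * ∫ w, conjDensity Ω₁ Ω₂ (w, z) ∂boundaryLength Ω₁ := by
    intro z hz
    rw [integral_mul_const, h2 z hz, mul_assoc, ← integral_mul_const]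
    congr 2
    funext w
    simp only [conjDensity]
    ring
  rw [integral_congr_ae (ae_boundaryLength_of_forall h3), integral_const_mul]
  linear_combination (1 / 4 * ∫ z, ∫ w, conjDensity Ω₁ Ω₂ (w, z) ∂boundaryLength Ω₁
    ∂boundaryLength Ω₂) * I_sq

/-! ### Angles and real parts of the complex densities -/

theorem tangentAngle_cos {p v : ℂ} (hτ : ‖positiveTangent Ω p‖ = 1) (hv : v ≠ 0) :
    (tangentAngle Ω p v).cos = (v * conj (positiveTangent Ω p)).re / ‖v‖ := by
  have h0 : v * conj (positiveTangent Ω p) ≠ 0 := by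
    rw [← norm_ne_zero_iff, norm_mul, RCLike.norm_conj, hτ, mul_one]
    exact norm_ne_zero_iff.2 hv
  unfold tangentAngle Orientation.oangle
  rw [Complex.kahler, Real.Angle.cos_coe, cos_arg h0, norm_mul,
    RCLike.norm_conj, hτ, mul_one]

theorem tangentAngle_sin {p v : ℂ} (hτ : ‖positiveTangent Ω p‖ = 1) :
    (tangentAngle Ω p v).sin = (v * conj (positiveTangent Ω p)).im / ‖v‖ := by
  unfold tangentAngle Orientation.oangle
  rw [Complex.kahler, Real.Angle.sin_coe, sin_arg, norm_mul,
    RCLike.norm_conj, hτ, mul_one]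

theorem dotDensity_eq (p : ℂ × ℂ) : dotDensity Ω₁ Ω₂ p = (conjDensity Ω₁ Ω₂ p).re := by
  rw [conjDensity, mul_conj, re_mul_ofReal, normSq_eq_norm_sq, norm_inv, dotDensity]
  simp [div_eq_mul_inv]

/-- With `v = p.2 - p.1`, the product of `v τ̄₁` with the conjugate of `v τ̄₂` is `|v|² τ̄₁ τ₂`, of
argument `θ₁ - θ₂`. -/
theorem conjDensity_re {p : ℂ × ℂ} (hp : p.2 - p.1 ≠ 0) (h₁ : ‖positiveTangent Ω₁ p.1‖ = 1)
    (h₂ : ‖positiveTangent Ω₂ p.2‖ = 1) :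
    (conjDensity Ω₁ Ω₂ p).re = cosCosDensity Ω₁ Ω₂ p + sinSinDensity Ω₁ Ω₂ p := by
  rw [cosCosDensity, sinSinDensity, tangentAngle_cos h₁ hp, tangentAngle_cos h₂ hp,
    tangentAngle_sin h₁, tangentAngle_sin h₂]
  rw [← dotDensity_eq, dotDensity]
  have hn : ‖p.2 - p.1‖ ≠ 0 := norm_ne_zero_iff.2 hp
  have hn2 : ‖p.2 - p.1‖ ^ 2 = (p.2 - p.1).re * (p.2 - p.1).re + (p.2 - p.1).im * (p.2 - p.1).im := by
    rw [← normSq_eq_norm_sq, normSq_apply]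
  simp only [mul_re, mul_im, conj_re, conj_im]
  field_simp
  rw [hn2]
  ring

/-- Each factor `τᵢ / v` equals `e^{-iθᵢ} / |v|`, so the real part is `cos (θ₁ + θ₂) / |v|²`. -/
theorem holoDensity_re {p : ℂ × ℂ} (hp : p.2 - p.1 ≠ 0) (h₁ : ‖positiveTangent Ω₁ p.1‖ = 1)
    (h₂ : ‖positiveTangent Ω₂ p.2‖ = 1) :
    (holoDensity Ω₁ Ω₂ p).re = cosCosDensity Ω₁ Ω₂ p - sinSinDensity Ω₁ Ω₂ p := by
  rw [cosCosDensity, sinSinDensity, tangentAngle_cos h₁ hp, tangentAngle_cos h₂ hp,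
    tangentAngle_sin h₁, tangentAngle_sin h₂]
  have hn : ‖p.2 - p.1‖ ≠ 0 := norm_ne_zero_iff.2 hp
  have hinv : (p.2 - p.1)⁻¹ ^ 2 = conj (p.2 - p.1) ^ 2 * ((‖p.2 - p.1‖ ^ 4)⁻¹ : ℝ) := by
    rw [inv_def, normSq_eq_norm_sq, mul_pow, ← ofReal_pow, inv_pow, ← pow_mul]
  rw [holoDensity, hinv, ← mul_assoc, re_mul_ofReal]
  simp only [mul_re, mul_im, conj_re, conj_im, pow_two (conj (p.2 - p.1))]
  field_simp
  ring

end PlanarDomain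

open PlanarDomain in
theorem mainTheorem11 (Ω₁ Ω₂ : Set ℂ)
    (hΩ₁ : HasSmoothBoundary Ω₁) (hΩ₂ : HasSmoothBoundary Ω₂)
    (hK₁ : IsCompact (frontier Ω₁)) (hK₂ : IsCompact (frontier Ω₂))
    (hdisj : Disjoint (closure Ω₁) (closure Ω₂)) :
    (IntegrableOn energyDensity (Ω₁ ×ˢ Ω₂) ∧
      Integrable (cosCosDensity Ω₁ Ω₂) ((boundaryLength Ω₁).prod (boundaryLength Ω₂)) ∧
      Integrable (sinSinDensity Ω₁ Ω₂) ((boundaryLength Ω₁).prod (boundaryLength Ω₂)) ∧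
      Integrable (dotDensity Ω₁ Ω₂) ((boundaryLength Ω₁).prod (boundaryLength Ω₂))) ∧
    mutualEnergy Ω₁ Ω₂ =
      -(1 / 2) * ∫ p, cosCosDensity Ω₁ Ω₂ p ∂((boundaryLength Ω₁).prod (boundaryLength Ω₂)) ∧
    mutualEnergy Ω₁ Ω₂ =
      -(1 / 2) * ∫ p, sinSinDensity Ω₁ Ω₂ p ∂((boundaryLength Ω₁).prod (boundaryLength Ω₂)) ∧
    mutualEnergy Ω₁ Ω₂ =
      -(1 / 4) * ∫ p, dotDensity Ω₁ Ω₂ p ∂((boundaryLength Ω₁).prod (boundaryLength Ω₂)) := by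
  have := hΩ₂.isFiniteMeasure_boundaryLength hK₂
  set μ := (boundaryLength Ω₁).prod (boundaryLength Ω₂)
  have hcont := continuousOn_densities hΩ₁ hΩ₂ hdisj
  have hA := integrable_boundaryLength_prod hΩ₁ hΩ₂ hK₁ hK₂ hcont.1
  have hB := integrable_boundaryLength_prod hΩ₁ hΩ₂ hK₁ hK₂ hcont.2
  have hne : ∀ w ∈ frontier Ω₁, ∀ z ∈ frontier Ω₂, z - w ≠ 0 := fun w hw z hz h0 =>
    notMem_closure_of_disjoint hdisj (frontier_subset_closure hw)
      (sub_eq_zero.1 h0 ▸ frontier_subset_closure hz)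
  have hA_re : Integrable (fun p => (conjDensity Ω₁ Ω₂ p).re) μ := hA.re
  have hB_re : Integrable (fun p => (holoDensity Ω₁ Ω₂ p).re) μ := hB.re
  have hre : ∀ᵐ p ∂μ,
      (conjDensity Ω₁ Ω₂ p).re = cosCosDensity Ω₁ Ω₂ p + sinSinDensity Ω₁ Ω₂ p ∧
        (holoDensity Ω₁ Ω₂ p).re = cosCosDensity Ω₁ Ω₂ p - sinSinDensity Ω₁ Ω₂ p := by
    refine ae_boundaryLength_prod (P := fun p =>
      (conjDensity Ω₁ Ω₂ p).re = cosCosDensity Ω₁ Ω₂ p + sinSinDensity Ω₁ Ω₂ p ∧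
        (holoDensity Ω₁ Ω₂ p).re = cosCosDensity Ω₁ Ω₂ p - sinSinDensity Ω₁ Ω₂ p)
      fun w hw z hz => ?_
    have h1 := (positiveTangent_spec hΩ₁ hw).1
    have h2 := (positiveTangent_spec hΩ₂ hz).1
    exact ⟨conjDensity_re (hne w hw z hz) h1 h2, holoDensity_re (hne w hw z hz) h1 h2⟩
  -- As the holomorphic density integrates to zero, the cosine and sine densities each integrate to
  -- half of the conjugate one, which turns `-1/4` into `-1/2`.
  have hcos : (fun p => ((conjDensity Ω₁ Ω₂ p).re + (holoDensity Ω₁ Ω₂ p).re) / 2) =ᵐ[μ]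
      cosCosDensity Ω₁ Ω₂ := by
    filter_upwards [hre] with p hp
    rw [hp.1, hp.2]
    ring
  have hsin : (fun p => ((conjDensity Ω₁ Ω₂ p).re - (holoDensity Ω₁ Ω₂ p).re) / 2) =ᵐ[μ]
      sinSinDensity Ω₁ Ω₂ := by
    filter_upwards [hre] with p hp
    rw [hp.1, hp.2]
    ring
  have hdot : dotDensity Ω₁ Ω₂ = fun p => (conjDensity Ω₁ Ω₂ p).re := funext dotDensity_eq
  have hE : mutualEnergy Ω₁ Ω₂ = -(1 / 4) * ∫ p, (conjDensity Ω₁ Ω₂ p).re ∂μ := by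
    have h := congrArg Complex.re
      (mutualEnergy_eq_integral_conjDensity hΩ₁ hΩ₂ hK₁ hK₂ hdisj)
    have h4 : (-(1 / 4) : ℂ) = ((-(1 / 4) : ℝ) : ℂ) := by push_cast; rfl
    rw [h4, Complex.re_ofReal_mul, Complex.ofReal_re] at h
    exact h.trans (congrArg (_ * ·) (Complex.reCLM.integral_comp_comm hA).symm)
  have h0 : ∫ p, (holoDensity Ω₁ Ω₂ p).re ∂μ = 0 := by
    have h := Complex.reCLM.integral_comp_comm hB
    rw [integral_holoDensity hΩ₁ hΩ₂ hK₁ hK₂ hdisj, map_zero] at h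
    exact h
  refine ⟨⟨integrableOn_energyDensity hK₁ hK₂ hdisj, ((hA_re.add hB_re).div_const 2).congr hcos,
    ((hA_re.sub hB_re).div_const 2).congr hsin, hdot ▸ hA_re⟩, ?_, ?_, ?_⟩
  · rw [← integral_congr_ae hcos, integral_div, integral_add hA_re hB_re, h0, hE]
    ring
  · rw [← integral_congr_ae hsin, integral_div, integral_sub hA_re hB_re, h0, hE]
    ring
  · rw [hdot, hE]
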